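/- Setting. Let $n\ge 0$ and let $\mathcal M$ be a smooth spacetime manifold of dimension $d+1=n+2$ (Hausdorff, $\sigma$-compact). The dynamical fields $\phi$ are smooth sections of a finite-dimensional tensor bundle (a bundle associated with a smooth representation of $GL(n+2,\mathbb R)$) with values in an open $GL$-invariant subset; for instance a Lorentzian metric together with tensor matter fields. Diffeomorphisms act by $I_{\hat\xi}\delta\phi=\pounds_\xi\phi$. Field-space forms are smooth local functionals of $\phi$ and its variations with values in differential forms on $\mathcal M$; $\delta$ and $I$ are exterior derivative and contraction on field space, $L_V=I_V\delta+\delta I_V$, and $\Delta_{\hat\xi}=L_{\hat\xi}-\pounds_\xi-I_{\widehat{\delta\xi}}$ is the anomaly operator. A theory is given by a Lagrangian $(n+2)$-form $L'$, field equations $E$ and a symplectic potential $\theta'$ with $\delta L'=E\cdot\delta\phi+d\theta'$, such that $\Delta_{\hat\zeta}(E\cdot\delta\phi)=0$ for all smooth vector fields $\zeta$, together with $b'$, $\lambda'$ satisfying $\Delta_{\hat\zeta}L'=d\Delta_{\hat\zeta}b'$ and $\Delta_{\hat\zeta}\theta'=\Delta_{\hat\zeta}\delta b'+d\Delta_{\hat\zeta}\lambda'$.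 Let $\mathcal U\subset\mathcal M$ be open, let $\iota:\mathcal N\to\mathcal M$ be a smoothly embedded hypersurface contained in $\partial\mathcal U$, and let $\mathscr S_{\mathcal U}$ be the set of field configurations with $E=0$ on $\mathcal U$, its tangent vectors being the solutions of the linearized equations on $\mathcal U$. Suppose that on $\mathscr S_{\mathcal U}$ $$\iota^*\theta'=-\delta\ell'+d\beta'+\mathcal E ,$$ with $\ell'$ and $\beta'$ local spacetime forms (pulled back to $\mathcal N$ here) and $\mathcal E$ a field-space one-form with values in $(n+1)$-forms on $\mathcal N$. Let $Q_\zeta$ be Noether potentials: for every smooth vector field $\zeta$, on solutions $Q_\zeta$ is a smooth form with $dQ_\zeta=I_{\hat\zeta}(\theta'-\delta b'-d\lambda')-i_\zeta(L'-db')$ on $\overline{\mathcal U}$. For a possibly field-dependent vector field $\xi$ put $$h_\xi=Q_\xi+i_\xi b'+I_{\hat\xi}\lambda'+i_\xi\ell'-I_{\hat\xi}\beta',\qquad H_\xi(S)=\int_S h_\xi .$$ Claim. At every $\phi\in\mathscr S_{\mathcal U}$ at which $\xi$ is smooth, the following holds. (1) Pulled back to $\mathcal N$, $$dh_\xi=I_{\hat\xi}\mathcal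 E-\Delta_{\hat\xi}(\ell'+b')-i_\xi(L'+d\ell').$$ (2) Suppose moreover that $\xi$ is tangent to $\mathcal N$ and that $\mathcal N$ is oriented. Let $S$ be a closed oriented $n$-manifold, let $\Phi:\mathbb R\times S\to\mathcal N$ be smooth, and let $S_1=\Phi(0,\cdot)$ and $S_2=\Phi(1,\cdot)$ be two cuts of $\mathcal N$ between which the cuts $\Phi(t,\cdot)$, $0\le t\le1$, sweep out the region $\mathcal N_1^2$ from past to future. Suppose that the cuts are oriented oppositely to the orientation induced on them as boundary of their past in $\mathcal N$, i.e. $(\Phi^*\eta)(\partial_t,v_1,\dots,v_n)\,\mu(v_1,\dots,v_n)\le0$ for all $v_1,\dots,v_n\in T_xS$, $x\in S$, $0\le t\le 1$, where $\eta$, $\mu$ are nowhere vanishing top forms that define the orientations of $\mathcal N$ and $S$. Then $$H_\xi(S_2)-H_\xi(S_1)=-\int_{\mathcal N_1^2}\bigl(I_{\hat\xi}\mathcal E-\Delta_{\hat\xi}(\ell'+b')\bigr),$$ where the integral is that of the pullback by $\Phi$ over $[0,1]\times S$ in the orientation $\Phi^*\eta$. -/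

import Mathlib

open scoped Manifold ContDiff Topology
open Set Filter MeasureTheory

noncomputable section

namespace CovPhase

/-- The model space `ℝᵐ`. -/
abbrev Euc (m : ℕ) : Type := EuclideanSpace ℝ (Fin m)

/-! ### Exterior calculus on a smooth manifold

`TangentSpace (𝓡 m) x` is by definition `Euc m`: a tangent vector at `x` is given by its components
in the preferred chart at `x`. Vector fields, differential forms and tensor fields are written in
the same way, and `tangentCoordChange` gives their components in any other chart. -/

/-- Vector fields on the `m`-manifold `X`, `ξ x ∈ T_x X`. -/
abbrev VField (m : ℕ) (X : Type*) := X → Euc m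

/-- Differential `k`-forms on the `m`-manifold `X`, `α x` an alternating form on `T_x X`. -/
abbrev DForm (m : ℕ) (X : Type*) (k : ℕ) := X → (Euc m) [⋀^Fin k]→L[ℝ] ℝ

section Manifold

variable {m k : ℕ} {X : Type*} [TopologicalSpace X] [ChartedSpace (Euc m) X]
  [IsManifold (𝓡 m) ∞ X]

/-- Components of a vector field in the preferred chart at `x₀`. -/
def coordVec (ξ : VField m X) (x₀ : X) (y : Euc m) : Euc m :=
  let p := (extChartAt (𝓡 m) x₀).symm y
  tangentCoordChange (𝓡 m) p x₀ p (ξ p)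

/-- Components of a differential form in the preferred chart at `x₀` (the pullback of the form by
the inverse chart). -/
def coordForm (α : DForm m X k) (x₀ : X) (y : Euc m) : (Euc m) [⋀^Fin k]→L[ℝ] ℝ :=
  let p := (extChartAt (𝓡 m) x₀).symm y
  (α p).compContinuousLinearMap (tangentCoordChange (𝓡 m) x₀ p p)

/-- Smooth vector fields. -/
def IsSmoothVField (ξ : VField m X) : Prop :=
  ∀ x₀ : X, ContDiffOn ℝ ∞ (coordVec ξ x₀) (extChartAt (𝓡 m) x₀).target

/-- Smooth differential forms. -/
def IsSmoothForm (α : DForm m X k) : Prop :=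
  ∀ x₀ : X, ContDiffOn ℝ ∞ (coordForm α x₀) (extChartAt (𝓡 m) x₀).target

/-- Exterior derivative on the manifold `X`. -/
def extD (α : DForm m X k) : DForm m X (k + 1) :=
  fun x => extDeriv (coordForm α x) (extChartAt (𝓡 m) x x)

/-- Jacobian matrix of the components of `ξ`, at `x`, in the preferred chart at `x`. -/
def jacobian (ξ : VField m X) (x : X) : Euc m →L[ℝ] Euc m :=
  fderiv ℝ (coordVec ξ x) (extChartAt (𝓡 m) x x)

/-- Lie derivative of a differential form, in local coordinates:
`(£_ξ α)(v₁, …, v_k) = (ξ^c ∂_c α)(v₁, …, v_k) + ∑ᵢ α(v₁, …, ∂ξ · vᵢ, …, v_k)`. The sum over `i` is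
the derivative at `t = 0` of `α((1 + t ∂ξ) v₁, …, (1 + t ∂ξ) v_k)`. -/
def lieForm (ξ : VField m X) (α : DForm m X k) : DForm m X k :=
  fun x => fderiv ℝ (coordForm α x) (extChartAt (𝓡 m) x x) (ξ x)
    + deriv (fun t : ℝ => (α x).compContinuousLinearMap
        (ContinuousLinearMap.id ℝ (Euc m) + t • jacobian ξ x)) 0

/-- Pullback of a differential form by a smooth map `f : Y → X`. -/
def pullback {r : ℕ} {Y : Type*} [TopologicalSpace Y] [ChartedSpace (Euc r) Y]
    (f : Y → X) (α : DForm m X k) : DForm r Y k :=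
  fun y => (α (f y)).compContinuousLinearMap (mfderiv (𝓡 r) (𝓡 m) f y : Euc r →L[ℝ] Euc m)

end Manifold

/-! ### Integration -/

section Integration

variable {n : ℕ} {S : Type*} [TopologicalSpace S] [ChartedSpace (Euc n) S]
  [IsManifold (𝓡 n) ∞ S] [CompactSpace S] [T2Space S]

/-- A smooth partition of unity subordinate to the preferred charts. -/
def chartPartition (n : ℕ) (S : Type*) [TopologicalSpace S] [ChartedSpace (Euc n) S]
    [IsManifold (𝓡 n) ∞ S] [CompactSpace S] [T2Space S] :
    SmoothPartitionOfUnity S (𝓡 n) S univ :=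
  Classical.choose (SmoothPartitionOfUnity.exists_isSubordinate_chartAt_source (𝓡 n) S)

/-- The component `α_{1 … n}` of a top form in the chart at `x₀`. -/
def topCoeff (α : DForm n S n) (x₀ : S) (y : Euc n) : ℝ :=
  coordForm α x₀ y (fun j => EuclideanSpace.single j (1 : ℝ))

/-- The integral `∫_S α` of a top form over the closed manifold `S`, oriented by the sign of the top
form `o` (for an orientation, `o` is nowhere vanishing). -/
def formIntegral (o α : DForm n S n) : ℝ :=
  ∑ᶠ i : S, ∫ y in (extChartAt (𝓡 n) i).target,
    chartPartition n S i ((extChartAt (𝓡 n) i).symm y) *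
      (Real.sign (topCoeff o i y) * topCoeff α i y)

variable {N : Type*} [TopologicalSpace N] [ChartedSpace (Euc (n + 1)) N]
  [IsManifold (𝓡 (n + 1)) ∞ N]

/-- For `Φ : ℝ × S → N` and a top form `ζ` on `N`: the top form `i_{∂_t} (Φ^* ζ)` on `{t} × S`, that is
`v₁, …, v_n ↦ ζ (∂_t Φ, dΦ v₁, …, dΦ v_n)`. -/
def slicePullback (Φ : ℝ × S → N) (ζ : DForm (n + 1) N (n + 1)) (t : ℝ) : DForm n S n :=
  fun x =>
    ((ζ (Φ (t, x))).curryLeft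
        ((mfderiv 𝓘(ℝ, ℝ) (𝓡 (n + 1)) (fun s : ℝ => Φ (s, x)) t : ℝ →L[ℝ] Euc (n + 1)) 1)
      ).compContinuousLinearMap
      (mfderiv (𝓡 n) (𝓡 (n + 1)) (fun x' : S => Φ (t, x')) x : Euc n →L[ℝ] Euc (n + 1))

/-- The integral of `ζ` over the region `Φ([0,1] × S)` of `N`, where `N` is oriented by the top form `η`:
the integral over `[0,1] × S`, computed slice by slice, of `Φ^* ζ` in the orientation `Φ^* η`. -/
def regionIntegral (η : DForm (n + 1) N (n + 1)) (Φ : ℝ × S → N)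
    (ζ : DForm (n + 1) N (n + 1)) : ℝ :=
  ∫ t in (0 : ℝ)..1, formIntegral (slicePullback Φ η t) (slicePullback Φ ζ t)

/-- The cuts `{t} × S`, oriented by `μ`, carry the orientation opposite to the one induced on them as
boundary of their past in `N`, where `N` is oriented by `η`; `∂_t Φ` points from the past to the future,
hence outward. -/
def OppositeToBoundaryOfPast (η : DForm (n + 1) N (n + 1)) (Φ : ℝ × S → N) (μ : DForm n S n) :
    Prop :=
  ∀ t ∈ Icc (0 : ℝ) 1, ∀ (x : S) (v : Fin n → Euc n), slicePullback Φ η t x v * μ x v ≤ 0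

end Integration

/-! ### Dynamical fields -/

/-- The type of the dynamical fields on an `m`-dimensional spacetime: they are the sections of the
tensor bundle with typical fibre `W` associated with a smooth representation `rep` of `GL(m, ℝ)`, and
take values in an open invariant subset `adm` of it. For example `W` is the direct sum of the symmetric
covariant 2-tensors and of any tensor types for the matter fields, and `adm` says that the first
component, the metric, has Lorentzian signature. (`rep A` has no meaning for singular `A`.) -/
structure FieldType (m : ℕ) (W : Type*) [NormedAddCommGroup W] [NormedSpace ℝ W] where
  rep : (Euc m →L[ℝ] Euc m) → (W →L[ℝ] W)
  rep_one : rep 1 = 1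
  rep_mul : ∀ A B, IsUnit A → IsUnit B → rep (A * B) = rep A * rep B
  rep_smooth : ContDiffOn ℝ ∞ rep {A | IsUnit A}
  adm : Set W
  adm_open : IsOpen adm
  adm_invariant : ∀ A, IsUnit A → ∀ w ∈ adm, rep A w ∈ adm

section Fields

variable {m : ℕ} {W : Type*} [NormedAddCommGroup W] [NormedSpace ℝ W] (F : FieldType m W)
  {M : Type*} [TopologicalSpace M] [ChartedSpace (Euc m) M] [IsManifold (𝓡 m) ∞ M]

/-- Components in the preferred chart at `x₀` of the field `φ`, whose value `φ x : W` consists of the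
components at `x` in the preferred chart at `x`. -/
def coordField (φ : M → W) (x₀ : M) (y : Euc m) : W :=
  let p := (extChartAt (𝓡 m) x₀).symm y
  F.rep (tangentCoordChange (𝓡 m) p x₀ p) (φ p)

/-- Smooth sections. -/
def IsSmoothField (φ : M → W) : Prop :=
  ∀ x₀ : M, ContDiffOn ℝ ∞ (coordField F φ x₀) (extChartAt (𝓡 m) x₀).target

/-- Smooth families of sections with parameter `s ∈ ℝʳ`. -/
def IsSmoothFamily {r : ℕ} (φ : Euc r → M → W) : Prop :=
  ∀ x₀ : M, ContDiffOn ℝ ∞ (fun q : Euc r × Euc m => coordField F (φ q.1) x₀ q.2)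
    (univ ×ˢ (extChartAt (𝓡 m) x₀).target)

/-- Points of the field configuration space. -/
def IsConfig (φ : M → W) : Prop := IsSmoothField F φ ∧ ∀ x, φ x ∈ F.adm

/-- Lie derivative of the fields, in local coordinates: `£_ξ φ = ξ^c ∂_c φ - rep_* (∂ξ) φ`, with `rep_*`
the derivative of `rep` at the identity. -/
def lieField (ξ : VField m M) (φ : M → W) : M → W :=
  fun x => fderiv ℝ (coordField F φ x) (extChartAt (𝓡 m) x x) (ξ x)
    - (fderiv ℝ F.rep 1 (jacobian ξ x)) (φ x)

end Fields

/-! ### Differential forms on field space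

A form of field-space degree `p` and spacetime degree `k` on the `m`-manifold `X` assigns to a field
configuration `φ` and to variations `χ₁, …, χ_p` of the fields a `k`-form on `X`. -/

/-- Field space forms of degree `p`, with values in the `k`-forms on `X`. -/
abbrev FSForm (M W : Type*) (m : ℕ) (X : Type*) (p k : ℕ) :=
  (M → W) → (Fin p → (M → W)) → DForm m X k

section FieldSpace

variable {M W : Type*} [NormedAddCommGroup W] [NormedSpace ℝ W]
  {m : ℕ} {X : Type*} {p k : ℕ}

/-- The exterior derivative `δ` on field space:
`(δα)_φ(χ₀, …, χ_p) = ∑ᵢ (-1)ⁱ d/dε|₀ α_{φ + ε χᵢ}(χ₀, …, χ̂ᵢ, …, χ_p)`, pointwise on `X`. -/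
def fsD (α : FSForm M W m X p k) : FSForm M W m X (p + 1) k :=
  fun φ χ x => ∑ i : Fin (p + 1),
    (-1 : ℝ) ^ (i : ℕ) • deriv (fun ε : ℝ => α (φ + ε • χ i) (i.removeNth χ) x) 0

/-- Contraction `I_V` with a vector field `V` on field space. -/
def fsContract (V : (M → W) → (M → W)) (α : FSForm M W m X (p + 1) k) : FSForm M W m X p k :=
  fun φ χ => α φ (Fin.cons (V φ) χ)

/-- Contraction `I_ν` with a vector-valued one-form `ν` on field space (a derivation of degree `0`). -/
def fsContractOne (ν : (M → W) → (M → W) → (M → W)) (α : FSForm M W m X p k) :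
    FSForm M W m X p k :=
  fun φ χ => ∑ i : Fin p, α φ (Function.update χ i (ν φ (χ i)))

/-- The Lie derivative `L_V = I_V δ + δ I_V` on field space (`I_V` vanishes on degree `0`). -/
def fsLie (V : (M → W) → (M → W)) : {p : ℕ} → FSForm M W m X p k → FSForm M W m X p k
  | 0, α => fsContract V (fsD α)
  | _ + 1, α => fsContract V (fsD α) + fsD (fsContract V α)

end FieldSpace

section Anomaly

variable {m : ℕ} {W : Type*} [NormedAddCommGroup W] [NormedSpace ℝ W] (F : FieldType m W)
  {M : Type*} [TopologicalSpace M] [ChartedSpace (Euc m) M] [IsManifold (𝓡 m) ∞ M] {p k : ℕ}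

/-- The spacetime exterior derivative `d` on field space forms. -/
def stD {r : ℕ} {X : Type*} [TopologicalSpace X] [ChartedSpace (Euc r) X] [IsManifold (𝓡 r) ∞ X]
    (α : FSForm M W r X p k) : FSForm M W r X p (k + 1) :=
  fun φ χ => extD (α φ χ)

/-- The spacetime contraction `i_ξ`, with a possibly field-dependent vector field `ξ`. -/
def stContract (ξ : (M → W) → VField m M) (α : FSForm M W m M p (k + 1)) : FSForm M W m M p k :=
  fun φ χ x => (α φ χ x).curryLeft (ξ φ x)

/-- The spacetime Lie derivative `£_ξ`, with a possibly field-dependent vector field `ξ`. -/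
def stLie (ξ : (M → W) → VField m M) (α : FSForm M W m M p k) : FSForm M W m M p k :=
  fun φ χ => lieForm (ξ φ) (α φ χ)

/-- Pullback of field space forms along a map of spacetime manifolds. -/
def stPullback {r : ℕ} {N : Type*} [TopologicalSpace N] [ChartedSpace (Euc r) N]
    (f : N → M) (α : FSForm M W m M p k) : FSForm M W r N p k :=
  fun φ χ => pullback f (α φ χ)

/-- The vector field `ξ̂` on field space, `I_ξ̂ δφ = £_ξ φ`. -/
def hat (ξ : (M → W) → VField m M) : (M → W) → (M → W) := fun φ => lieField F (ξ φ) φ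

/-- The vector-valued one-form on field space that belongs to `δξ`: `χ ↦ £_{δξ(χ)} φ`. -/
def hatVariation (ξ : (M → W) → VField m M) : (M → W) → (M → W) → (M → W) :=
  fun φ χ => lieField F (fun x => deriv (fun ε : ℝ => ξ (φ + ε • χ) x) 0) φ

/-- The anomaly operator `Δ_ξ̂ = L_ξ̂ - £_ξ - I_{δξ}`. -/
def anomaly (ξ : (M → W) → VField m M) (α : FSForm M W m M p k) : FSForm M W m M p k :=
  fsLie (hat F ξ) α - stLie ξ α - fsContractOne (hatVariation F ξ) α

/-- Smooth local field space forms: at a configuration that is admissible at `x` the form is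
multilinear and alternating in the variations, its value at `x` depends on the germs at `x` of `φ` and of
the variations (in particular it may depend on finitely many derivatives at `x`, and on background
structures), and it is smooth along smooth families of fields and variations, jointly with the point
of spacetime. -/
structure IsLocalForm (α : FSForm M W m M p k) : Prop where
  map_lin : ∀ (φ : M → W) (χ : Fin p → M → W) (i : Fin p) (u v : M → W) (a b : ℝ) (x : M),
    IsSmoothField F φ → φ x ∈ F.adm → (∀ j, IsSmoothField F (χ j)) → IsSmoothField F u →
    IsSmoothField F v →
    α φ (Function.update χ i (a • u + b • v)) x
      = a • α φ (Function.update χ i u) x + b • α φ (Function.update χ i v) x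
  map_alt : ∀ (φ : M → W) (χ : Fin p → M → W) (i j : Fin p) (x : M),
    IsSmoothField F φ → φ x ∈ F.adm → (∀ j, IsSmoothField F (χ j)) → i ≠ j → χ i = χ j →
    α φ χ x = 0
  locality : ∀ (φ φ' : M → W) (χ χ' : Fin p → M → W) (x : M),
    IsSmoothField F φ → IsSmoothField F φ' → (∀ i, IsSmoothField F (χ i)) →
    (∀ i, IsSmoothField F (χ' i)) → φ x ∈ F.adm →
    φ =ᶠ[𝓝 x] φ' → (∀ i, χ i =ᶠ[𝓝 x] χ' i) → α φ χ x = α φ' χ' x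
  smooth : ∀ (r : ℕ) (φ : Euc r → M → W) (χ : Fin p → Euc r → M → W),
    IsSmoothFamily F φ → (∀ i, IsSmoothFamily F (χ i)) →
    ∀ (s : Euc r) (x : M), φ s x ∈ F.adm →
      ContDiffAt ℝ ∞ (fun q : Euc r × Euc m => coordForm (α (φ q.1) (fun i => χ i q.1)) x q.2)
        (s, extChartAt (𝓡 m) x x)

end Anomaly

/-! ### Theories, solution space, charges -/

section Theories

variable {n : ℕ} {W : Type*} [NormedAddCommGroup W] [NormedSpace ℝ W] (F : FieldType (n + 2) W)
  (M : Type*) [TopologicalSpace M] [ChartedSpace (Euc (n + 2)) M] [IsManifold (𝓡 (n + 2)) ∞ M]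

/-- The one-form `E · δφ` on field space. -/
def eomForm {M W : Type*} [NormedAddCommGroup W] [NormedSpace ℝ W] {n : ℕ}
    (E : (M → W) → M → W →L[ℝ] ((Euc (n + 2)) [⋀^Fin (n + 2)]→L[ℝ] ℝ)) :
    FSForm M W (n + 2) M 1 (n + 2) :=
  fun φ χ x => E φ x (χ 0 x)

/-- A diffeomorphism-invariant theory on an `(n + 2)`-dimensional spacetime: a Lagrangian `L'`, field
equations `E` and a symplectic potential `θ'` with `δL' = E · δφ + dθ'`, such that `E · δφ` has no
anomaly, together with `b'` and `λ'` that are defined by `Δ_ξ̂ L' = d Δ_ξ̂ b'` and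
`Δ_ξ̂ θ' = Δ_ξ̂ δb' + d Δ_ξ̂ λ'`. None of `L'`, `θ'`, `b'`, `λ'` needs to be covariant. -/
structure Theory where
  L : FSForm M W (n + 2) M 0 (n + 2)
  E : (M → W) → M → W →L[ℝ] ((Euc (n + 2)) [⋀^Fin (n + 2)]→L[ℝ] ℝ)
  θ : FSForm M W (n + 2) M 1 (n + 1)
  b : FSForm M W (n + 2) M 0 (n + 1)
  lam : FSForm M W (n + 2) M 1 n
  local_L : IsLocalForm F L
  local_E : IsLocalForm F (eomForm E)
  local_θ : IsLocalForm F θ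
  local_b : IsLocalForm F b
  local_lam : IsLocalForm F lam
  variation_L : ∀ φ, IsConfig F φ → ∀ χ, (∀ i, IsSmoothField F (χ i)) →
    fsD L φ χ = eomForm E φ χ + stD θ φ χ
  invariant_E : ∀ ξ : VField (n + 2) M, IsSmoothVField ξ →
    ∀ φ, IsConfig F φ → ∀ χ, (∀ i, IsSmoothField F (χ i)) →
    anomaly F (fun _ => ξ) (eomForm E) φ χ = 0
  anomaly_L : ∀ ξ : VField (n + 2) M, IsSmoothVField ξ →
    ∀ φ, IsConfig F φ → ∀ χ, (∀ i, IsSmoothField F (χ i)) →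
    anomaly F (fun _ => ξ) L φ χ = stD (anomaly F (fun _ => ξ) b) φ χ
  anomaly_θ : ∀ ξ : VField (n + 2) M, IsSmoothVField ξ →
    ∀ φ, IsConfig F φ → ∀ χ, (∀ i, IsSmoothField F (χ i)) →
    anomaly F (fun _ => ξ) θ φ χ
      = anomaly F (fun _ => ξ) (fsD b) φ χ + stD (anomaly F (fun _ => ξ) lam) φ χ

variable {F M} (T : Theory F M)

/-- The covariant Lagrangian `L' - db'`. -/
def covL : FSForm M W (n + 2) M 0 (n + 2) := T.L - stD T.b

/-- The covariant symplectic potential `θ' - δb' - dλ'`. -/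
def covθ : FSForm M W (n + 2) M 1 (n + 1) := T.θ - fsD T.b - stD T.lam

/-- The solution space of the subregion `U`. -/
def IsSolution (U : Set M) (φ : M → W) : Prop := IsConfig F φ ∧ ∀ x ∈ U, T.E φ x = 0

/-- Tangent vectors of the solution space at `φ`: solutions of the linearized field equations. -/
def IsTangent (U : Set M) (φ χ : M → W) : Prop :=
  IsSmoothField F χ ∧ ∀ x ∈ U, deriv (fun ε : ℝ => T.E (φ + ε • χ) x) 0 = 0

/-- The Noether current of the covariant Lagrangian and symplectic potential,
`I_ξ̂ (θ' - δb' - dλ') - i_ξ (L' - db')`. -/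
def covNoetherCurrent (ξ : (M → W) → VField (n + 2) M) : FSForm M W (n + 2) M 0 (n + 1) :=
  fsContract (hat F ξ) (covθ T) - stContract ξ (covL T)

/-- `Q` is a choice of Noether potentials: `Q ζ` is a potential, on solutions, for the covariant Noether
current of the vector field `ζ`. -/
def IsNoetherPotential (U : Set M)
    (Q : VField (n + 2) M → FSForm M W (n + 2) M 0 n) : Prop :=
  ∀ ζ : VField (n + 2) M, IsSmoothVField ζ → ∀ φ, IsSolution T U φ → ∀ χ,
    IsSmoothForm (Q ζ φ χ) ∧
    ∀ x ∈ closure U, stD (Q ζ) φ χ x = covNoetherCurrent T (fun _ => ζ) φ χ x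

/-- `Q'_ξ = Q_ξ + i_ξ b' + I_ξ̂ λ'`. -/
def noetherCharge (Q : VField (n + 2) M → FSForm M W (n + 2) M 0 n)
    (ξ : (M → W) → VField (n + 2) M) : FSForm M W (n + 2) M 0 n :=
  (fun φ χ => Q (ξ φ) φ χ) + stContract ξ T.b + fsContract (hat F ξ) T.lam

/-- The charge density `h_ξ = Q'_ξ + i_ξ ℓ' - I_ξ̂ β'`. -/
def chargeDensity (Q : VField (n + 2) M → FSForm M W (n + 2) M 0 n)
    (ℓ : FSForm M W (n + 2) M 0 (n + 1)) (β : FSForm M W (n + 2) M 1 n)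
    (ξ : (M → W) → VField (n + 2) M) : FSForm M W (n + 2) M 0 n :=
  noetherCharge T Q ξ + stContract ξ ℓ - fsContract (hat F ξ) β

variable {N : Type*} [TopologicalSpace N] [ChartedSpace (Euc (n + 1)) N]
  [IsManifold (𝓡 (n + 1)) ∞ N]

/-- The decomposition, on the hypersurface `ι : N → M`, of the pullback of the symplectic potential into
boundary, corner and flux terms: `ι^* θ' = -δℓ' + dβ' + ℰ`, as one-forms on the solution space. -/
def IsBoundaryDecomposition (U : Set M) (ι : N → M) (ℓ : FSForm M W (n + 2) M 0 (n + 1))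
    (β : FSForm M W (n + 2) M 1 n) (ℰ : FSForm M W (n + 1) N 1 (n + 1)) : Prop :=
  ∀ φ, IsSolution T U φ → ∀ χ, (∀ i, IsTangent T U φ (χ i)) →
    stPullback ι T.θ φ χ
      = - stPullback ι (fsD ℓ) φ χ + stD (stPullback ι β) φ χ + ℰ φ χ

/-- The vector field `ξ` is tangent to the hypersurface `ι : N → M`. -/
def IsTangentTo (ι : N → M) (ξ : VField (n + 2) M) : Prop :=
  ∀ q : N, ∃ v : Euc (n + 1),
    (mfderiv (𝓡 (n + 1)) (𝓡 (n + 2)) ι q : Euc (n + 1) →L[ℝ] Euc (n + 2)) v = ξ (ι q)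

/-- The localized charge `H_ξ = ∫ h_ξ` of the cut `c : S → N`, oriented by `μ`, in the configuration
`φ`. -/
def charge (Q : VField (n + 2) M → FSForm M W (n + 2) M 0 n)
    (ℓ : FSForm M W (n + 2) M 0 (n + 1)) (β : FSForm M W (n + 2) M 1 n)
    (ξ : (M → W) → VField (n + 2) M) (ι : N → M)
    {S : Type*} [TopologicalSpace S] [ChartedSpace (Euc n) S] [IsManifold (𝓡 n) ∞ S]
    [CompactSpace S] [T2Space S] (μ : DForm n S n) (c : S → N) (φ : M → W) : ℝ :=
  formIntegral μ (pullback (ι ∘ c) (chargeDensity T Q ℓ β ξ φ ![]))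

end Theories

end CovPhase

end

noncomputable section

set_option linter.unusedSectionVars false

namespace CovPhase

/-! ### Alternating forms depending on a parameter -/

section Alternating

variable {E F X : Type*} [NormedAddCommGroup E] [NormedSpace ℝ E]
  [NormedAddCommGroup F] [NormedSpace ℝ F]
  [NormedAddCommGroup X] [NormedSpace ℝ X] {k : ℕ} {r : ℕ∞ω}

/-! Part (1) is a computation on the solution space. The Noether identity supplies `dQ_ξ` on the
closure of `U`, hence on `N`, which lies in the frontier. The boundary decomposition of the
symplectic potential may be contracted with `ξ̂` only if `£_ξ φ` is a tangent vector of the solution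
space; this is `isTangent_lieField`, and it follows from the vanishing anomaly of `E · δφ`: on shell
that condition reduces to the derivative of `E` along `£_ξ φ`, paired with an arbitrary variation.
After that, Cartan's formula turns `Δ_ξ̂(ℓ' + b')` into `I_ξ̂ δ - d i_ξ - i_ξ d`, the contributions
of `dλ'` and `dβ'` cancel, and what remains is `stD_chargeDensity`. A field-dependent `ξ` causes no
extra terms: every form involved in the anomaly has field-space degree zero, where `I_{δξ}` is an
empty sum, so only the vector field `ξ φ` enters.

Part (2) applies the homotopy formula to `α = ι^* h_ξ`. With `Φ_t` the cut at time `t`, the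
derivative of `Φ_t^* α` is `i_{∂_t} Φ^* dα + d(i_{∂_t} Φ^* α)`. The exact term integrates to zero
over the closed manifold `S` by Stokes' theorem (`formIntegral_extD_eq_zero`), so the fundamental
theorem of calculus and Fubini give `formIntegral_pullback_sub`. Tangency of `ξ` makes the pullback
of `i_ξ(L' + dℓ')` vanish, so `dα` is the stated flux density. The overall minus sign comes from the
orientation of the cuts (`formIntegral_slicePullback`).

Much of the work concerns charts. Forms and fields are recorded by their components in a different
preferred chart at each point, so that exterior and Lie derivatives are defined with a varying
chart. Their smoothness and chart independence follow from naturality: `extDeriv_pb` for forms and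
`lieCoord_transform` for tensor fields. -/

/-- Currying of alternating forms, as a continuous linear map. -/
def curryLeftL (E : Type*) [NormedAddCommGroup E] [NormedSpace ℝ E] (k : ℕ) :
    (E [⋀^Fin (k + 1)]→L[ℝ] ℝ) →L[ℝ] (E →L[ℝ] E [⋀^Fin k]→L[ℝ] ℝ) :=
  ContinuousAlternatingMap.curryLeftLI.toContinuousLinearMap

theorem curryLeftL_apply (α : E [⋀^Fin (k + 1)]→L[ℝ] ℝ) : curryLeftL E k α = α.curryLeft := rfl

theorem hasFDerivAt_clm_apply₂ {A G H : Type*} [NormedAddCommGroup A] [NormedSpace ℝ A]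
    [NormedAddCommGroup G] [NormedSpace ℝ G] [NormedAddCommGroup H] [NormedSpace ℝ H]
    (L : A →L[ℝ] G →L[ℝ] H) {f : X → A} {f' : X →L[ℝ] A} {v : X → G} {v' : X →L[ℝ] G} {x : X}
    (hf : HasFDerivAt f f' x) (hv : HasFDerivAt v v' x) :
    HasFDerivAt (fun y => L (f y) (v y)) (L (f x) ∘L v' + (L ∘L f').flip (v x)) x :=
  (L.hasFDerivAt.comp x hf).clm_apply hv

/-- An alternating form on a finite-dimensional space is determined by its values on tuples of basis
vectors; a linear left inverse of this evaluation reconstructs it. Smoothness of a family of forms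
can therefore be tested on fixed vectors. -/
theorem exists_clm_of_alternating_apply [FiniteDimensional ℝ E] :
    ∃ (d : ℕ) (v : Fin d → Fin k → E) (L : (Fin d → ℝ) →L[ℝ] (E [⋀^Fin k]→L[ℝ] ℝ)),
      ∀ α : E [⋀^Fin k]→L[ℝ] ℝ, L (fun j => α (v j)) = α := by
  let b := Module.finBasis ℝ E
  let e := Fintype.equivFin (Fin k → Fin (Module.finrank ℝ E))
  let f : (E [⋀^Fin k]→L[ℝ] ℝ) →ₗ[ℝ]
      (Fin (Fintype.card (Fin k → Fin (Module.finrank ℝ E))) → ℝ) :=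
    { toFun := fun α j => α (fun i => b (e.symm j i))
      map_add' := fun _ _ => rfl
      map_smul' := fun _ _ => rfl }
  have hf : LinearMap.ker f = ⊥ := by
    rw [LinearMap.ker_eq_bot]
    intro α α' h
    have : α.toMultilinearMap = α'.toMultilinearMap := by
      refine Module.Basis.ext_multilinear (fun _ => b) fun s => ?_
      have := congrFun h (e s)
      simpa [f] using this
    ext v
    exact congrArg (fun g : MultilinearMap ℝ (fun _ : Fin k => E) ℝ => g v) this
  obtain ⟨g, hg⟩ := LinearMap.exists_leftInverse_of_injective f hf
  refine ⟨_, fun j i => b (e.symm j i), LinearMap.toContinuousLinearMap g, fun α => ?_⟩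
  exact congrArg (fun h : (E [⋀^Fin k]→L[ℝ] ℝ) →ₗ[ℝ] (E [⋀^Fin k]→L[ℝ] ℝ) => h α) hg

theorem contDiffAt_alternating_iff [FiniteDimensional ℝ E] {f : X → E [⋀^Fin k]→L[ℝ] ℝ} {x : X} :
    ContDiffAt ℝ r f x ↔ ∀ v, ContDiffAt ℝ r (fun y => f y v) x := by
  constructor
  · intro h v
    exact ((ContinuousAlternatingMap.apply ℝ E ℝ v).contDiff.contDiffAt).comp x h
  · intro h
    obtain ⟨d, v, L, hL⟩ := exists_clm_of_alternating_apply (E := E) (k := k)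
    have : f = fun y => L (fun j => f y (v j)) := by
      funext y; rw [hL]
    rw [this]
    exact L.contDiff.contDiffAt.comp x (contDiffAt_pi.2 fun j => h (v j))

theorem contDiffAt_curryLeft_apply {f : X → E [⋀^Fin (k + 1)]→L[ℝ] ℝ} {v : X → E} {x : X}
    (hf : ContDiffAt ℝ r f x) (hv : ContDiffAt ℝ r v x) :
    ContDiffAt ℝ r (fun y => (f y).curryLeft (v y)) x := by
  have h : ContDiffAt ℝ r (fun y => curryLeftL E k (f y)) x := by
    have h1 := ContinuousLinearMap.contDiff (𝕜 := ℝ) (E := E [⋀^Fin (k + 1)]→L[ℝ] ℝ)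
      (F := E →L[ℝ] E [⋀^Fin k]→L[ℝ] ℝ) (n := r)
      (curryLeftL E k)
    exact h1.contDiffAt.comp x hf
  exact h.clm_apply hv

/-- Induction on the degree: currying feeds in one vector at a time and reduces the claim to
evaluation of linear maps. -/
theorem contDiffAt_alternating_apply : ∀ {k : ℕ} {f : X → E [⋀^Fin k]→L[ℝ] ℝ}
    {v : X → Fin k → E} {x : X}, ContDiffAt ℝ r f x → (∀ i, ContDiffAt ℝ r (fun y => v y i) x) →
    ContDiffAt ℝ r (fun y => f y (v y)) x
  | 0, f, v, x, hf, hv => by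
    have : (fun y => f y (v y)) = fun y => f y ![] := by
      funext y; congr 1; exact Subsingleton.elim _ _
    rw [this]
    exact ((ContinuousAlternatingMap.apply ℝ E ℝ _).contDiff.contDiffAt).comp x hf
  | k + 1, f, v, x, hf, hv => by
    have : (fun y => f y (v y)) = fun y => (f y).curryLeft (v y 0) (fun i => v y i.succ) := by
      funext y
      rw [ContinuousAlternatingMap.curryLeft_apply_apply]
      congr 1
      exact (Fin.cons_self_tail (v y)).symm
    rw [this]
    exact contDiffAt_alternating_apply (contDiffAt_curryLeft_apply hf (hv 0)) fun i => hv i.succ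

theorem contDiffAt_compContinuousLinearMap [FiniteDimensional ℝ E]
    {f : X → F [⋀^Fin k]→L[ℝ] ℝ} {g : X → E →L[ℝ] F} {x : X}
    (hf : ContDiffAt ℝ r f x) (hg : ContDiffAt ℝ r g x) :
    ContDiffAt ℝ r (fun y => (f y).compContinuousLinearMap (g y)) x := by
  rw [contDiffAt_alternating_iff]
  intro v
  exact contDiffAt_alternating_apply (v := fun y i => g y (v i)) hf
    fun i => hg.clm_apply contDiffAt_const

theorem contDiffAt_extDeriv {f : E → E [⋀^Fin k]→L[ℝ] ℝ} {x : E} (hf : ContDiffAt ℝ ∞ f x) :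
    ContDiffAt ℝ ∞ (extDeriv f) x := by
  have h : ContDiffAt ℝ ∞ (fderiv ℝ f) x := hf.fderiv_right (m := ∞) (by simp)
  exact (ContinuousAlternatingMap.alternatizeUncurryFinCLM ℝ E ℝ).contDiff.contDiffAt.comp x h

/-- Cartan's formula for forms on a vector space. -/
theorem extDeriv_curryLeft {α : E → E [⋀^Fin (k + 1)]→L[ℝ] ℝ} {v : E → E} {x : E}
    (hα : DifferentiableAt ℝ α x) (hv : DifferentiableAt ℝ v x) :
    extDeriv (fun y => (α y).curryLeft (v y)) x + (extDeriv α x).curryLeft (v x)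
      = fderiv ℝ α x (v x)
        + (α x).fderivCompContinuousLinearMap (ContinuousLinearMap.id ℝ E) (fderiv ℝ v x) := by
  have hd : fderiv ℝ (fun y => (α y).curryLeft (v y)) x
      = (α x).curryLeft ∘L fderiv ℝ v x + ((curryLeftL E k ∘L fderiv ℝ α x).flip (v x)) := by
    exact (hasFDerivAt_clm_apply₂ (A := E [⋀^Fin (k + 1)]→L[ℝ] ℝ) (G := E)
      (H := E [⋀^Fin k]→L[ℝ] ℝ) (curryLeftL E k) hα.hasFDerivAt hv.hasFDerivAt).fderiv
  have hr : ∀ (u : E) (w : Fin (k + 1) → E) (i : Fin (k + 1)),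
      i.succ.removeNth (Fin.cons u w : Fin (k + 2) → E) = Fin.cons u (i.removeNth w) := by
    intro u w i
    cases k with
    | zero =>
      funext j
      obtain rfl : i = 0 := Fin.eq_zero i
      obtain rfl : j = 0 := Fin.eq_zero j
      rfl
    | succ k => funext j; refine Fin.cases ?_ (fun j => ?_) j <;> simp [Fin.removeNth]
  rw [extDeriv, hd, ContinuousAlternatingMap.alternatizeUncurryFin_add,
    ContinuousAlternatingMap.fderivCompContinuousLinearMap_eq_alternatizeUncurryFin]
  ext w
  -- In the alternating sum for `dα(v, w)` the term of index 0 is the derivative along `v`. The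
  -- remaining terms carry the opposite sign to the alternatization of the derivative of `α` with
  -- `v` held fixed, and cancel it.
  have h1 : ContinuousAlternatingMap.alternatizeUncurryFin
      ((curryLeftL E k ∘L fderiv ℝ α x).flip (v x)) w + (extDeriv α x).curryLeft (v x) w
      = fderiv ℝ α x (v x) w := by
    rw [ContinuousAlternatingMap.curryLeft_apply_apply, extDeriv,
      ContinuousAlternatingMap.alternatizeUncurryFin_apply,
      ContinuousAlternatingMap.alternatizeUncurryFin_apply, Fin.sum_univ_succ (n := k + 1)]
    have : ∀ i : Fin (k + 1), Fin.removeNth i.succ (Matrix.vecCons (v x) w) =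
      Matrix.vecCons (v x) (i.removeNth w) := hr (v x) w
    simp only [this]
    simp [pow_succ, curryLeftL_apply, Matrix.vecCons]
  rw [ContinuousAlternatingMap.add_apply, ContinuousAlternatingMap.add_apply, add_assoc, h1,
    ContinuousAlternatingMap.add_apply, add_comm]
  congr 1

/-- Identifies the Jacobian term in the definition of `lieForm` with the term produced by Cartan's
formula in a vector space. -/
theorem deriv_compContinuousLinearMap_id_add_smul (α : E [⋀^Fin k]→L[ℝ] ℝ) (A : E →L[ℝ] E) :
    deriv (fun t : ℝ => α.compContinuousLinearMap (ContinuousLinearMap.id ℝ E + t • A)) 0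
      = α.fderivCompContinuousLinearMap (ContinuousLinearMap.id ℝ E) A := by
  have h : HasFDerivAt (fun t : ℝ => ContinuousLinearMap.id ℝ E + t • A)
      ((ContinuousLinearMap.id ℝ ℝ).smulRight A) 0 :=
    ((ContinuousLinearMap.id ℝ ℝ).smulRight A).hasFDerivAt.const_add _
  have := ((hasFDerivAt_const α (0 : ℝ)).continuousAlternatingMapCompContinuousLinearMap
    h).hasDerivAt.deriv
  rw [this]
  simp

end Alternating

/-! ### Forms on manifolds in charts -/

section Charts

variable {m k : ℕ} {X : Type*} [TopologicalSpace X] [ChartedSpace (Euc m) X]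

theorem extChartAt_target_nhds {x₀ : X} {y : Euc m} (hy : y ∈ (extChartAt (𝓡 m) x₀).target) :
    (extChartAt (𝓡 m) x₀).target ∈ 𝓝 y :=
  (isOpen_extChartAt_target x₀).mem_nhds hy

variable [IsManifold (𝓡 m) ∞ X]

theorem tangentCoordChange_self' (x : X) :
    tangentCoordChange (𝓡 m) x x x = ContinuousLinearMap.id ℝ (Euc m) := by
  ext1 v
  exact tangentCoordChange_self (mem_extChartAt_source x)

theorem contMDiffAt_extChartAt_symm {x₀ : X} {y : Euc m}
    (hy : y ∈ (extChartAt (𝓡 m) x₀).target) :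
    ContMDiffAt 𝓘(ℝ, Euc m) (𝓡 m) ∞ (extChartAt (𝓡 m) x₀).symm y :=
  (contMDiffOn_extChartAt_symm x₀).contMDiffAt (extChartAt_target_nhds hy)

theorem mfderiv_extChartAt_symm {x₀ : X} {y : Euc m} (hy : y ∈ (extChartAt (𝓡 m) x₀).target) :
    (mfderiv 𝓘(ℝ, Euc m) (𝓡 m) (extChartAt (𝓡 m) x₀).symm y : Euc m →L[ℝ] Euc m)
      = tangentCoordChange (𝓡 m) x₀ ((extChartAt (𝓡 m) x₀).symm y)
          ((extChartAt (𝓡 m) x₀).symm y) := by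
  have h : MDifferentiableAt 𝓘(ℝ, Euc m) (𝓡 m) (extChartAt (𝓡 m) x₀).symm y :=
    (contMDiffAt_extChartAt_symm hy).mdifferentiableAt (by simp)
  refine h.mfderiv.trans ?_
  rw [tangentCoordChange_def, (extChartAt (𝓡 m) x₀).right_inv hy]
  rfl

variable {E : Type*} [NormedAddCommGroup E] [NormedSpace ℝ E]

theorem mfderiv_eq_comp_fderiv {f : E → X} {z : E} {x₀ : X}
    (hf : MDifferentiableAt 𝓘(ℝ, E) (𝓡 m) f z) (hz : f z ∈ (extChartAt (𝓡 m) x₀).source) :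
    (mfderiv 𝓘(ℝ, E) (𝓡 m) f z : E →L[ℝ] Euc m)
      = tangentCoordChange (𝓡 m) x₀ (f z) (f z) ∘L fderiv ℝ (extChartAt (𝓡 m) x₀ ∘ f) z := by
  have hg : MDifferentiableAt 𝓘(ℝ, E) 𝓘(ℝ, Euc m) (extChartAt (𝓡 m) x₀ ∘ f) z :=
    (mdifferentiableAt_extChartAt (by simpa using hz)).comp z hf
  have ht : (extChartAt (𝓡 m) x₀ ∘ f) z ∈ (extChartAt (𝓡 m) x₀).target :=
    (extChartAt (𝓡 m) x₀).map_source hz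
  have he : f =ᶠ[𝓝 z] (extChartAt (𝓡 m) x₀).symm ∘ (extChartAt (𝓡 m) x₀ ∘ f) := by
    filter_upwards [hf.continuousAt.preimage_mem_nhds
      ((isOpen_extChartAt_source x₀).mem_nhds hz)] with w hw
    exact ((extChartAt (𝓡 m) x₀).left_inv hw).symm
  have h1 := mfderiv_comp z
    ((contMDiffAt_extChartAt_symm ht).mdifferentiableAt (by simp)) hg
  refine he.mfderiv_eq.trans (h1.trans ?_)
  have h2 := mfderiv_extChartAt_symm ht
  simp only [Function.comp_apply, (extChartAt (𝓡 m) x₀).left_inv hz] at h2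
  have h3 : mfderiv 𝓘(ℝ, E) 𝓘(ℝ, Euc m) (extChartAt (𝓡 m) x₀ ∘ f) z
    = fderiv ℝ (extChartAt (𝓡 m) x₀ ∘ f) z := mfderiv_eq_fderiv
  ext1 v
  exact (congrArg (fun A : Euc m →L[ℝ] Euc m => A _) h2).trans
    (congrArg (fun A : E →L[ℝ] Euc m => tangentCoordChange (𝓡 m) x₀ (f z) (f z) (A v)) h3)

/-- The pullback of a form on a manifold along a map from a vector space. -/
def pb (f : E → X) (α : DForm m X k) : E → E [⋀^Fin k]→L[ℝ] ℝ :=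
  fun z => (α (f z)).compContinuousLinearMap (mfderiv 𝓘(ℝ, E) (𝓡 m) f z : E →L[ℝ] Euc m)

/-- Smoothness of a form at a point. -/
def SmoothFormAt (α : DForm m X k) (x : X) : Prop :=
  ContDiffAt ℝ ∞ (coordForm α x) (extChartAt (𝓡 m) x x)

/-- Chart components are a pullback along the inverse chart, so the naturality results for `pb`
cover changes of chart and maps between manifolds at once. -/
theorem coordForm_eq_pb (α : DForm m X k) {x₀ : X} {y : Euc m}
    (hy : y ∈ (extChartAt (𝓡 m) x₀).target) :
    coordForm α x₀ y = pb (extChartAt (𝓡 m) x₀).symm α y := by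
  rw [pb, mfderiv_extChartAt_symm hy]
  rfl

theorem coordForm_self (α : DForm m X k) (x : X) :
    coordForm α x (extChartAt (𝓡 m) x x) = α x := by
  simp only [coordForm, extChartAt_to_inv, tangentCoordChange_self']
  ext v
  simp

theorem pb_eq_coordForm (α : DForm m X k) {f : E → X} {z : E} {x₀ : X}
    (hf : MDifferentiableAt 𝓘(ℝ, E) (𝓡 m) f z) (hz : f z ∈ (extChartAt (𝓡 m) x₀).source) :
    pb f α z = (coordForm α x₀ (extChartAt (𝓡 m) x₀ (f z))).compContinuousLinearMap
      (fderiv ℝ (extChartAt (𝓡 m) x₀ ∘ f) z) := by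
  rw [pb, mfderiv_eq_comp_fderiv hf hz]
  simp only [coordForm, (extChartAt (𝓡 m) x₀).left_inv hz]
  rfl

theorem pb_eventuallyEq (α : DForm m X k) {f : E → X} {z : E} {x₀ : X}
    (hf : ContMDiffAt 𝓘(ℝ, E) (𝓡 m) ∞ f z) (hz : f z ∈ (extChartAt (𝓡 m) x₀).source) :
    pb f α =ᶠ[𝓝 z] fun w => (coordForm α x₀ ((extChartAt (𝓡 m) x₀ ∘ f) w)).compContinuousLinearMap
      (fderiv ℝ (extChartAt (𝓡 m) x₀ ∘ f) w) := by
  -- Smoothness of order `∞` at a point does not spread to one neighbourhood, but order 1 does, and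
  -- differentiability nearby is all that is needed.
  filter_upwards [hf.continuousAt.preimage_mem_nhds
    ((isOpen_extChartAt_source x₀).mem_nhds hz),
    (contMDiffAt_iff_contMDiffAt_nhds (n := 1) (by simp)).1 (hf.of_le (by simp))] with w hw hfw
  exact pb_eq_coordForm α (hfw.mdifferentiableAt (by simp)) hw

theorem contDiffAt_extChartAt_comp {f : E → X} {z : E} {x₀ : X}
    (hf : ContMDiffAt 𝓘(ℝ, E) (𝓡 m) ∞ f z) (hz : f z ∈ (extChartAt (𝓡 m) x₀).source) :
    ContDiffAt ℝ ∞ (extChartAt (𝓡 m) x₀ ∘ f) z :=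
  ((contMDiffOn_extChartAt (n := ∞) (x := x₀)).contMDiffAt
      ((chartAt (Euc m) x₀).open_source.mem_nhds (by simpa using hz)) |>.comp z hf :
      ContMDiffAt 𝓘(ℝ, E) 𝓘(ℝ, Euc m) ∞ (extChartAt (𝓡 m) x₀ ∘ f) z).contDiffAt

theorem contDiffAt_pb [FiniteDimensional ℝ E] {α : DForm m X k} {f : E → X} {z : E}
    (hα : SmoothFormAt α (f z)) (hf : ContMDiffAt 𝓘(ℝ, E) (𝓡 m) ∞ f z) :
    ContDiffAt ℝ ∞ (pb f α) z := by
  have hz := mem_extChartAt_source (I := 𝓡 m) (f z)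
  have hg := contDiffAt_extChartAt_comp hf hz
  refine ContDiffAt.congr_of_eventuallyEq ?_ (pb_eventuallyEq α hf hz)
  exact contDiffAt_compContinuousLinearMap (ContDiffAt.comp (g := coordForm α (f z)) z hα hg)
    (hg.fderiv_right (m := ∞) (by simp))

/-- Near `z` the pullback factors through the chart at `f z`, which reduces the claim to the
pullback formula between vector spaces. At `z` itself the coordinate change is the identity. -/
theorem extDeriv_pb {α : DForm m X k} {f : E → X} {z : E}
    (hα : SmoothFormAt α (f z)) (hf : ContMDiffAt 𝓘(ℝ, E) (𝓡 m) ∞ f z) :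
    extDeriv (pb f α) z = pb f (extD α) z := by
  have hz := mem_extChartAt_source (I := 𝓡 m) (f z)
  have hg := contDiffAt_extChartAt_comp hf hz
  rw [(pb_eventuallyEq α hf hz).extDeriv_eq,
    extDeriv_pullback (f := extChartAt (𝓡 m) (f z) ∘ f) (hα.differentiableAt (by simp)) hg
      (by simpa using WithTop.coe_le_coe.2 (le_top : (2 : ℕ∞) ≤ ⊤)),
    pb, mfderiv_eq_comp_fderiv (hf.mdifferentiableAt (by simp)) hz, tangentCoordChange_self']
  rfl

theorem IsSmoothForm.smoothFormAt {α : DForm m X k} (h : IsSmoothForm α) (x : X) :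
    SmoothFormAt α x :=
  (h x).contDiffAt (extChartAt_target_mem_nhds x)

theorem contDiffAt_coordForm {α : DForm m X k} {x₀ : X} {y : Euc m}
    (hy : y ∈ (extChartAt (𝓡 m) x₀).target)
    (h : SmoothFormAt α ((extChartAt (𝓡 m) x₀).symm y)) :
    ContDiffAt ℝ ∞ (coordForm α x₀) y := by
  refine (contDiffAt_pb h (contMDiffAt_extChartAt_symm hy)).congr_of_eventuallyEq ?_
  filter_upwards [extChartAt_target_nhds hy] with w hw
  exact coordForm_eq_pb α hw

theorem isSmoothForm_iff {α : DForm m X k} : IsSmoothForm α ↔ ∀ x, SmoothFormAt α x :=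
  ⟨fun h x => h.smoothFormAt x, fun h _ _ hy => (contDiffAt_coordForm hy (h _)).contDiffWithinAt⟩

/-- `extD` uses a different chart at every point. Since `d` commutes with pullback along the inverse
chart at `x₀`, it is computed by that single chart on the whole chart domain, which makes smoothness
of `extD α` visible. -/
theorem coordForm_extD {α : DForm m X k} {x₀ : X} {y : Euc m}
    (hy : y ∈ (extChartAt (𝓡 m) x₀).target)
    (h : SmoothFormAt α ((extChartAt (𝓡 m) x₀).symm y)) :
    coordForm (extD α) x₀ y = extDeriv (coordForm α x₀) y := by
  rw [coordForm_eq_pb _ hy, ← extDeriv_pb h (contMDiffAt_extChartAt_symm hy)]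
  refine (EventuallyEq.extDeriv_eq ?_).symm
  filter_upwards [extChartAt_target_nhds hy] with w hw
  exact coordForm_eq_pb α hw

theorem IsSmoothForm.extD {α : DForm m X k} (h : IsSmoothForm α) : IsSmoothForm (extD α) := by
  intro x₀ y hy
  refine ContDiffAt.contDiffWithinAt ?_
  refine (contDiffAt_extDeriv (contDiffAt_coordForm hy (h.smoothFormAt _))).congr_of_eventuallyEq ?_
  filter_upwards [extChartAt_target_nhds hy] with w hw
  exact coordForm_extD hw (h.smoothFormAt _)

theorem coordForm_add (α β : DForm m X k) (x₀ : X) :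
    coordForm (α + β) x₀ = coordForm α x₀ + coordForm β x₀ := rfl

theorem SmoothFormAt.add {α β : DForm m X k} {x : X} (hα : SmoothFormAt α x)
    (hβ : SmoothFormAt β x) : SmoothFormAt (α + β) x := by
  rw [SmoothFormAt, coordForm_add]
  exact ContDiffAt.add hα hβ

theorem coordForm_smul (c : ℝ) (α : DForm m X k) (x₀ : X) :
    coordForm (c • α) x₀ = c • coordForm α x₀ := rfl

theorem SmoothFormAt.smul {α : DForm m X k} {x : X} (c : ℝ) (hα : SmoothFormAt α x) :
    SmoothFormAt (c • α) x := by
  rw [SmoothFormAt, coordForm_smul]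
  exact ContDiffAt.const_smul c hα

theorem extD_add {α β : DForm m X k} {x : X} (hα : SmoothFormAt α x) (hβ : SmoothFormAt β x) :
    extD (α + β) x = extD α x + extD β x :=
  extDeriv_add (hα.differentiableAt (by simp)) (hβ.differentiableAt (by simp))

theorem extD_smul (c : ℝ) (α : DForm m X k) (x : X) : extD (c • α) x = c • extD α x :=
  extDeriv_smul c (coordForm α x)

theorem sub_eq_add_neg_one_smul (α β : DForm m X k) : α - β = α + (-1 : ℝ) • β := by
  funext x
  ext v
  simp [sub_eq_add_neg]

theorem SmoothFormAt.sub {α β : DForm m X k} {x : X} (hα : SmoothFormAt α x)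
    (hβ : SmoothFormAt β x) : SmoothFormAt (α - β) x := by
  rw [sub_eq_add_neg_one_smul]
  exact hα.add (hβ.smul (-1))

theorem extD_sub {α β : DForm m X k} {x : X} (hα : SmoothFormAt α x) (hβ : SmoothFormAt β x) :
    extD (α - β) x = extD α x - extD β x := by
  rw [sub_eq_add_neg_one_smul, extD_add hα (hβ.smul (-1)), extD_smul]
  ext v
  simp [sub_eq_add_neg]

/-! ### Pullback along maps of manifolds -/

section Pullback

variable {r : ℕ} {Y : Type*} [TopologicalSpace Y] [ChartedSpace (Euc r) Y] [IsManifold (𝓡 r) ∞ Y]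

theorem pb_comp {f : Y → X} {g : E → Y} {z : E} (α : DForm m X k)
    (hf : MDifferentiableAt (𝓡 r) (𝓡 m) f (g z)) (hg : MDifferentiableAt 𝓘(ℝ, E) (𝓡 r) g z) :
    pb (f ∘ g) α z = pb g (pullback (r := r) f α) z := by
  rw [pb, mfderiv_comp z hf hg]
  rfl

theorem coordForm_pullback {f : Y → X} (hf : ContMDiff (𝓡 r) (𝓡 m) ∞ f) (α : DForm m X k)
    {y₀ : Y} {z : Euc r} (hz : z ∈ (extChartAt (𝓡 r) y₀).target) :
    coordForm (pullback (r := r) f α) y₀ z = pb (f ∘ (extChartAt (𝓡 r) y₀).symm) α z := by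
  rw [coordForm_eq_pb _ hz, pb_comp α (hf.mdifferentiable (by simp) _)
    ((contMDiffAt_extChartAt_symm hz).mdifferentiableAt (by simp))]

theorem smoothFormAt_pullback {f : Y → X} (hf : ContMDiff (𝓡 r) (𝓡 m) ∞ f) {α : DForm m X k}
    {y : Y} (hα : SmoothFormAt α (f y)) : SmoothFormAt (pullback (r := r) f α) y := by
  have hy := mem_extChartAt_target (I := 𝓡 r) y
  have hα' : SmoothFormAt α ((f ∘ (extChartAt (𝓡 r) y).symm) (extChartAt (𝓡 r) y y)) := by
    simpa using hα
  refine (contDiffAt_pb hα' (hf.contMDiffAt.comp _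
    (contMDiffAt_extChartAt_symm hy))).congr_of_eventuallyEq ?_
  filter_upwards [extChartAt_target_nhds hy] with w hw
  exact coordForm_pullback hf α hw

theorem extD_pullback {f : Y → X} (hf : ContMDiff (𝓡 r) (𝓡 m) ∞ f) {α : DForm m X k}
    {y : Y} (hα : SmoothFormAt α (f y)) :
    extD (pullback (r := r) f α) y = pullback (r := r) f (extD α) y := by
  have hy := mem_extChartAt_target (I := 𝓡 r) y
  have hα' : SmoothFormAt α ((f ∘ (extChartAt (𝓡 r) y).symm) (extChartAt (𝓡 r) y y)) := by
    simpa using hα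
  have h1 : coordForm (pullback (r := r) f α) y =ᶠ[𝓝 (extChartAt (𝓡 r) y y)]
      pb (f ∘ (extChartAt (𝓡 r) y).symm) α := by
    filter_upwards [extChartAt_target_nhds hy] with w hw
    exact coordForm_pullback hf α hw
  rw [extD, h1.extDeriv_eq, extDeriv_pb hα' (hf.contMDiffAt.comp _
    (contMDiffAt_extChartAt_symm hy)), ← coordForm_pullback hf _ hy, coordForm_self]

theorem pullback_pullback {s : ℕ} {Z : Type*} [TopologicalSpace Z] [ChartedSpace (Euc s) Z]
    {f : Y → X} {g : Z → Y} (hf : ContMDiff (𝓡 r) (𝓡 m) ∞ f) (hg : ContMDiff (𝓡 s) (𝓡 r) ∞ g)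
    (α : DForm m X k) :
    pullback (r := s) (f ∘ g) α = pullback (r := s) g (pullback (r := r) f α) := by
  funext z
  rw [pullback, mfderiv_comp z (hf.mdifferentiable (by simp) _)
    (hg.mdifferentiable (by simp) _)]
  rfl

end Pullback

/-! ### Contraction and Lie derivative -/

/-- The coordinate change applied to the form and the inverse one applied to the vector cancel. -/
theorem coordForm_curryLeft (α : DForm m X (k + 1)) (ζ : VField m X) {x₀ : X} {y : Euc m}
    (hy : y ∈ (extChartAt (𝓡 m) x₀).target) :
    coordForm (fun x => (α x).curryLeft (ζ x)) x₀ y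
      = (coordForm α x₀ y).curryLeft (coordVec ζ x₀ y) := by
  have hs := (extChartAt (𝓡 m) x₀).map_target hy
  simp only [coordForm, coordVec]
  rw [ContinuousAlternatingMap.curryLeft_compContinuousLinearMap,
    tangentCoordChange_comp ⟨⟨mem_extChartAt_source _, hs⟩, mem_extChartAt_source _⟩,
    tangentCoordChange_self (mem_extChartAt_source _)]

theorem coordVec_self (ζ : VField m X) (x : X) :
    coordVec ζ x (extChartAt (𝓡 m) x x) = ζ x := by
  simp only [coordVec, extChartAt_to_inv, tangentCoordChange_self']
  rfl

theorem IsSmoothVField.contDiffAt {ζ : VField m X} (h : IsSmoothVField ζ) {x₀ : X} {y : Euc m}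
    (hy : y ∈ (extChartAt (𝓡 m) x₀).target) : ContDiffAt ℝ ∞ (coordVec ζ x₀) y :=
  (h x₀).contDiffAt (extChartAt_target_nhds hy)

theorem SmoothFormAt.curryLeft {α : DForm m X (k + 1)} {ζ : VField m X} {x : X}
    (hα : SmoothFormAt α x) (hζ : IsSmoothVField ζ) :
    SmoothFormAt (fun x => (α x).curryLeft (ζ x)) x := by
  have hy := mem_extChartAt_target (I := 𝓡 m) x
  refine (contDiffAt_curryLeft_apply hα (hζ.contDiffAt hy)).congr_of_eventuallyEq ?_
  filter_upwards [extChartAt_target_nhds hy] with w hw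
  exact coordForm_curryLeft α ζ hw

/-- Cartan's formula. -/
theorem lieForm_eq {α : DForm m X (k + 1)} {ζ : VField m X} {x : X}
    (hα : SmoothFormAt α x) (hζ : IsSmoothVField ζ) :
    lieForm ζ α x = extD (fun x => (α x).curryLeft (ζ x)) x + (extD α x).curryLeft (ζ x) := by
  have hy := mem_extChartAt_target (I := 𝓡 m) x
  have he : coordForm (fun x => (α x).curryLeft (ζ x)) x =ᶠ[𝓝 (extChartAt (𝓡 m) x x)]
      fun y => (coordForm α x y).curryLeft (coordVec ζ x y) := by
    filter_upwards [extChartAt_target_nhds hy] with w hw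
    exact coordForm_curryLeft α ζ hw
  have := extDeriv_curryLeft (hα.differentiableAt (by simp))
    ((hζ.contDiffAt hy).differentiableAt (by simp))
  rw [coordVec_self, coordForm_self] at this
  rw [lieForm, deriv_compContinuousLinearMap_id_add_smul, extD, he.extDeriv_eq]
  exact this.symm

end Charts

/-! ### Coordinate transformations of fields -/

section FieldCoordinates

variable {m : ℕ} {W : Type*} [NormedAddCommGroup W] [NormedSpace ℝ W] (F : FieldType m W)

theorem FieldType.contDiffAt_rep {A : Euc m →L[ℝ] Euc m} (hA : IsUnit A) :
    ContDiffAt ℝ ∞ F.rep A :=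
  F.rep_smooth.contDiffAt (Units.isOpen.mem_nhds hA)

theorem FieldType.hasFDerivAt_rep {A : Euc m →L[ℝ] Euc m} (hA : IsUnit A) :
    HasFDerivAt F.rep (fderiv ℝ F.rep A) A :=
  ((F.contDiffAt_rep hA).differentiableAt (by simp)).hasFDerivAt

/-- Differentiate `rep (A C) = rep A · rep C` in `C` at `C = 1`; the units are open, so
multiplicativity holds near 1. The right-handed version differentiates `rep (C A)`. -/
theorem FieldType.fderiv_rep_mul_left {A : Euc m →L[ℝ] Euc m} (hA : IsUnit A)
    (Z : Euc m →L[ℝ] Euc m) :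
    fderiv ℝ F.rep A (A * Z) = F.rep A * fderiv ℝ F.rep 1 Z := by
  have h1 : HasFDerivAt (fun C => F.rep (A * C))
      (fderiv ℝ F.rep A ∘L ContinuousLinearMap.compL ℝ (Euc m) (Euc m) (Euc m) A) 1 := by
    refine HasFDerivAt.comp 1 (g := F.rep) ?_
      (ContinuousLinearMap.compL ℝ (Euc m) (Euc m) (Euc m) A).hasFDerivAt
    simpa using F.hasFDerivAt_rep hA
  have h2 : HasFDerivAt (fun C => F.rep A * F.rep C)
      (ContinuousLinearMap.compL ℝ W W W (F.rep A) ∘L fderiv ℝ F.rep 1) 1 :=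
    HasFDerivAt.comp 1 (ContinuousLinearMap.compL ℝ W W W (F.rep A)).hasFDerivAt
      (F.hasFDerivAt_rep isUnit_one)
  have h3 : (fun C => F.rep (A * C)) =ᶠ[𝓝 1] fun C => F.rep A * F.rep C := by
    filter_upwards [Units.isOpen.mem_nhds (isUnit_one (M := Euc m →L[ℝ] Euc m))] with C hC
    exact F.rep_mul A C hA hC
  exact congrArg (fun L : (Euc m →L[ℝ] Euc m) →L[ℝ] (W →L[ℝ] W) => L Z)
    (h1.unique (h2.congr_of_eventuallyEq h3))

theorem FieldType.fderiv_rep_mul_right {A : Euc m →L[ℝ] Euc m} (hA : IsUnit A)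
    (Z : Euc m →L[ℝ] Euc m) :
    fderiv ℝ F.rep A (Z * A) = fderiv ℝ F.rep 1 Z * F.rep A := by
  have h1 : HasFDerivAt (fun C => F.rep (C * A))
      (fderiv ℝ F.rep A ∘L (ContinuousLinearMap.compL ℝ (Euc m) (Euc m) (Euc m)).flip A) 1 := by
    refine HasFDerivAt.comp 1 (g := F.rep) ?_
      ((ContinuousLinearMap.compL ℝ (Euc m) (Euc m) (Euc m)).flip A).hasFDerivAt
    simpa using F.hasFDerivAt_rep hA
  have h2 : HasFDerivAt (fun C => F.rep C * F.rep A)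
      ((ContinuousLinearMap.compL ℝ W W W).flip (F.rep A) ∘L fderiv ℝ F.rep 1) 1 :=
    HasFDerivAt.comp 1 ((ContinuousLinearMap.compL ℝ W W W).flip (F.rep A)).hasFDerivAt
      (F.hasFDerivAt_rep isUnit_one)
  have h3 : (fun C => F.rep (C * A)) =ᶠ[𝓝 1] fun C => F.rep C * F.rep A := by
    filter_upwards [Units.isOpen.mem_nhds (isUnit_one (M := Euc m →L[ℝ] Euc m))] with C hC
    exact F.rep_mul C A hC hA
  exact congrArg (fun L : (Euc m →L[ℝ] Euc m) →L[ℝ] (W →L[ℝ] W) => L Z)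
    (h1.unique (h2.congr_of_eventuallyEq h3))

/-- The Lie derivative of a tensor field in a chart. -/
def lieCoord (ζ : Euc m → Euc m) (φ : Euc m → W) (y : Euc m) : W :=
  fderiv ℝ φ y (ζ y) - (fderiv ℝ F.rep 1 (fderiv ℝ ζ y)) (φ y)

/-- The Lie derivative of a tensor field is natural under changes of coordinates. -/
theorem lieCoord_transform {τ : Euc m → Euc m} {y : Euc m} (hτ : ContDiffAt ℝ ∞ τ y)
    (hA : IsUnit (fderiv ℝ τ y)) {ζ₀ ζ₁ : Euc m → Euc m} {φ₀ φ₁ : Euc m → W}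
    (hζ₀ : DifferentiableAt ℝ ζ₀ y) (hζ₁ : DifferentiableAt ℝ ζ₁ (τ y))
    (hφ₀ : DifferentiableAt ℝ φ₀ y) (hφ₁ : DifferentiableAt ℝ φ₁ (τ y))
    (hζ : ∀ᶠ w in 𝓝 y, ζ₁ (τ w) = fderiv ℝ τ w (ζ₀ w))
    (hφ : ∀ᶠ w in 𝓝 y, φ₁ (τ w) = F.rep (fderiv ℝ τ w) (φ₀ w)) :
    lieCoord F ζ₁ φ₁ (τ y) = F.rep (fderiv ℝ τ y) (lieCoord F ζ₀ φ₀ y) := by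
  have hτ1 : HasFDerivAt τ (fderiv ℝ τ y) y := (hτ.differentiableAt (by simp)).hasFDerivAt
  have hτ2 : HasFDerivAt (fderiv ℝ τ) (fderiv ℝ (fderiv ℝ τ) y) y :=
    ((hτ.fderiv_right (m := ∞) (by simp)).differentiableAt (by simp)).hasFDerivAt
  have hsymm : IsSymmSndFDerivAt ℝ τ y := hτ.isSymmSndFDerivAt
    (by simpa using WithTop.coe_le_coe.2 (le_top : (2 : ℕ∞) ≤ ⊤))
  -- The derivative of the transformation law of the vector field. Symmetry of the second derivative
  -- of `τ` moves `ζ₀ y` into the first slot.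
  have hJ : fderiv ℝ ζ₁ (τ y) * fderiv ℝ τ y
      = fderiv ℝ (fderiv ℝ τ) y (ζ₀ y) + fderiv ℝ τ y * fderiv ℝ ζ₀ y := by
    have h1 := hζ₁.hasFDerivAt.comp y hτ1
    have h2 := hτ2.clm_apply hζ₀.hasFDerivAt
    have h3 := h1.unique (h2.congr_of_eventuallyEq hζ)
    ext1 u
    have h4 := congrArg (fun L : Euc m →L[ℝ] Euc m => L u) h3
    simp only [ContinuousLinearMap.comp_apply, _root_.add_apply,
      ContinuousLinearMap.flip_apply] at h4
    simp only [mul_apply_eq_comp, _root_.add_apply, h4,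
      hsymm.eq (ζ₀ y) u]
    abel
  have hP : fderiv ℝ φ₁ (τ y) (ζ₁ (τ y))
      = fderiv ℝ F.rep (fderiv ℝ τ y) (fderiv ℝ (fderiv ℝ τ) y (ζ₀ y)) (φ₀ y)
        + F.rep (fderiv ℝ τ y) (fderiv ℝ φ₀ y (ζ₀ y)) := by
    have h1 := hφ₁.hasFDerivAt.comp y hτ1
    have h2 := ((F.hasFDerivAt_rep hA).comp y hτ2).clm_apply hφ₀.hasFDerivAt
    have h3 := h1.unique (h2.congr_of_eventuallyEq hφ)
    have h4 := congrArg (fun L : Euc m →L[ℝ] W => L (ζ₀ y)) h3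
    simp only [ContinuousLinearMap.comp_apply, _root_.add_apply,
      ContinuousLinearMap.flip_apply, Function.comp_apply] at h4
    rw [hζ.self_of_nhds, h4, add_comm]
  -- The inhomogeneous term with the second derivative of `τ` is the one found in `hP`; it drops out
  -- of the difference.
  have hR : fderiv ℝ F.rep 1 (fderiv ℝ ζ₁ (τ y)) (φ₁ (τ y))
      = fderiv ℝ F.rep (fderiv ℝ τ y) (fderiv ℝ (fderiv ℝ τ) y (ζ₀ y)) (φ₀ y)
        + F.rep (fderiv ℝ τ y) (fderiv ℝ F.rep 1 (fderiv ℝ ζ₀ y) (φ₀ y)) := by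
    rw [hφ.self_of_nhds, ← mul_apply_eq_comp, ← F.fderiv_rep_mul_right hA, hJ, map_add,
      F.fderiv_rep_mul_left hA]
    rfl
  rw [lieCoord, lieCoord, hP, hR, map_sub]
  abel

variable {M : Type*} [TopologicalSpace M] [ChartedSpace (Euc m) M] [IsManifold (𝓡 m) ∞ M]

theorem tangentCoordChange_mul {x₀ x₁ x₂ p : M} (h₀ : p ∈ (extChartAt (𝓡 m) x₀).source)
    (h₁ : p ∈ (extChartAt (𝓡 m) x₁).source) (h₂ : p ∈ (extChartAt (𝓡 m) x₂).source) :
    tangentCoordChange (𝓡 m) x₁ x₂ p * tangentCoordChange (𝓡 m) x₀ x₁ p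
      = tangentCoordChange (𝓡 m) x₀ x₂ p := by
  ext1 v
  exact tangentCoordChange_comp ⟨⟨h₀, h₁⟩, h₂⟩

theorem tangentCoordChange_eq_one {x₀ p : M} (h₀ : p ∈ (extChartAt (𝓡 m) x₀).source) :
    tangentCoordChange (𝓡 m) x₀ x₀ p = 1 := by
  ext1 v
  exact tangentCoordChange_self h₀

theorem isUnit_tangentCoordChange {x₀ x₁ p : M} (h₀ : p ∈ (extChartAt (𝓡 m) x₀).source)
    (h₁ : p ∈ (extChartAt (𝓡 m) x₁).source) :
    IsUnit (tangentCoordChange (𝓡 m) x₀ x₁ p) :=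
  ⟨⟨tangentCoordChange (𝓡 m) x₀ x₁ p, tangentCoordChange (𝓡 m) x₁ x₀ p,
    (tangentCoordChange_mul h₁ h₀ h₁).trans (tangentCoordChange_eq_one h₁),
    (tangentCoordChange_mul h₀ h₁ h₀).trans (tangentCoordChange_eq_one h₀)⟩, rfl⟩

/-- The transition map from the chart at `x₀` to the chart at `x₁`. -/
def transition (x₀ x₁ : M) : Euc m → Euc m :=
  extChartAt (𝓡 m) x₁ ∘ (extChartAt (𝓡 m) x₀).symm

theorem fderiv_transition {x₀ x₁ : M} {y : Euc m} (hy : y ∈ (extChartAt (𝓡 m) x₀).target) :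
    fderiv ℝ (transition x₀ x₁) y
      = tangentCoordChange (𝓡 m) x₀ x₁ ((extChartAt (𝓡 m) x₀).symm y) := by
  rw [tangentCoordChange_def, (extChartAt (𝓡 m) x₀).right_inv hy]
  simp [transition]

theorem contDiffAt_transition {x₀ x₁ : M} {y : Euc m}
    (hy : y ∈ (extChartAt (𝓡 m) x₀).target)
    (hy₁ : (extChartAt (𝓡 m) x₀).symm y ∈ (extChartAt (𝓡 m) x₁).source) :
    ContDiffAt ℝ ∞ (transition x₀ x₁) y :=
  contDiffAt_extChartAt_comp (contMDiffAt_extChartAt_symm hy) hy₁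

theorem eventually_mem_source {x₀ x₁ : M} {y : Euc m}
    (hy : y ∈ (extChartAt (𝓡 m) x₀).target)
    (hy₁ : (extChartAt (𝓡 m) x₀).symm y ∈ (extChartAt (𝓡 m) x₁).source) :
    ∀ᶠ w in 𝓝 y, w ∈ (extChartAt (𝓡 m) x₀).target ∧
      (extChartAt (𝓡 m) x₀).symm w ∈ (extChartAt (𝓡 m) x₁).source :=
  Eventually.and (extChartAt_target_nhds hy)
    ((contMDiffAt_extChartAt_symm hy).continuousAt.preimage_mem_nhds
      ((isOpen_extChartAt_source x₁).mem_nhds hy₁))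

theorem coordVec_transition (ζ : VField m M) {x₀ x₁ : M} {y : Euc m}
    (hy : y ∈ (extChartAt (𝓡 m) x₀).target)
    (hy₁ : (extChartAt (𝓡 m) x₀).symm y ∈ (extChartAt (𝓡 m) x₁).source) :
    coordVec ζ x₁ (transition x₀ x₁ y) = fderiv ℝ (transition x₀ x₁) y (coordVec ζ x₀ y) := by
  rw [fderiv_transition hy]
  simp only [coordVec, transition, Function.comp_apply, (extChartAt (𝓡 m) x₁).left_inv hy₁]
  exact (tangentCoordChange_comp ⟨⟨mem_extChartAt_source _,
    (extChartAt (𝓡 m) x₀).map_target hy⟩, hy₁⟩).symm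

theorem coordField_transition (φ : M → W) {x₀ x₁ : M} {y : Euc m}
    (hy : y ∈ (extChartAt (𝓡 m) x₀).target)
    (hy₁ : (extChartAt (𝓡 m) x₀).symm y ∈ (extChartAt (𝓡 m) x₁).source) :
    coordField F φ x₁ (transition x₀ x₁ y)
      = F.rep (fderiv ℝ (transition x₀ x₁) y) (coordField F φ x₀ y) := by
  have hs := (extChartAt (𝓡 m) x₀).map_target hy
  rw [fderiv_transition hy]
  simp only [coordField, transition, Function.comp_apply, (extChartAt (𝓡 m) x₁).left_inv hy₁]
  rw [← mul_apply_eq_comp, ← F.rep_mul _ _ (isUnit_tangentCoordChange hs hy₁)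
    (isUnit_tangentCoordChange (mem_extChartAt_source _) hs),
    tangentCoordChange_mul (mem_extChartAt_source _) hs hy₁]

theorem IsSmoothField.contDiffAt {φ : M → W} (h : IsSmoothField F φ) {x₀ : M} {y : Euc m}
    (hy : y ∈ (extChartAt (𝓡 m) x₀).target) : ContDiffAt ℝ ∞ (coordField F φ x₀) y :=
  (h x₀).contDiffAt (extChartAt_target_nhds hy)

theorem coordField_self (φ : M → W) (x : M) :
    coordField F φ x (extChartAt (𝓡 m) x x) = φ x := by
  simp only [coordField, extChartAt_to_inv]
  rw [tangentCoordChange_eq_one (mem_extChartAt_source _), F.rep_one]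
  rfl

theorem lieField_eq_lieCoord (ζ : VField m M) (φ : M → W) (x : M) :
    lieField F ζ φ x = lieCoord F (coordVec ζ x) (coordField F φ x) (extChartAt (𝓡 m) x x) := by
  rw [lieCoord, coordVec_self, coordField_self]
  rfl

/-- At `p` the Lie derivative is defined in the chart at `p`. Naturality under the transition map
carries it to the fixed chart at `x₀`, so that it can be differentiated there as a section. -/
theorem coordField_lieField {ζ : VField m M} (hζ : IsSmoothVField ζ) {φ : M → W}
    (hφ : IsSmoothField F φ) {x₀ : M} {y : Euc m} (hy : y ∈ (extChartAt (𝓡 m) x₀).target) :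
    coordField F (lieField F ζ φ) x₀ y = lieCoord F (coordVec ζ x₀) (coordField F φ x₀) y := by
  set p := (extChartAt (𝓡 m) x₀).symm y with hp
  have hs : p ∈ (extChartAt (𝓡 m) x₀).source := (extChartAt (𝓡 m) x₀).map_target hy
  have hps := mem_extChartAt_source (I := 𝓡 m) p
  have hpt := mem_extChartAt_target (I := 𝓡 m) p
  have hA : IsUnit (fderiv ℝ (transition x₀ p) y) := by
    rw [fderiv_transition hy]; exact isUnit_tangentCoordChange hs hps
  have ht : transition x₀ p y = extChartAt (𝓡 m) p p := rfl
  have h := lieCoord_transform F (contDiffAt_transition hy hps) hA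
    (ζ₀ := coordVec ζ x₀) (ζ₁ := coordVec ζ p) (φ₀ := coordField F φ x₀) (φ₁ := coordField F φ p)
    ((hζ.contDiffAt hy).differentiableAt (by simp))
    ((hζ.contDiffAt hpt).differentiableAt (by simp))
    ((hφ.contDiffAt F hy).differentiableAt (by simp))
    ((hφ.contDiffAt F hpt).differentiableAt (by simp))
    ((eventually_mem_source hy hps).mono fun w hw => coordVec_transition ζ hw.1 hw.2)
    ((eventually_mem_source hy hps).mono fun w hw => coordField_transition F φ hw.1 hw.2)
  rw [ht, ← lieField_eq_lieCoord, fderiv_transition hy] at h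
  have h2 : coordField F (lieField F ζ φ) x₀ y
    = F.rep (tangentCoordChange (𝓡 m) p x₀ p) (lieField F ζ φ p) := rfl
  rw [h2, h, ← mul_apply_eq_comp, ← F.rep_mul _ _ (isUnit_tangentCoordChange hps hs)
    (isUnit_tangentCoordChange hs hps), tangentCoordChange_mul hs hps hs,
    tangentCoordChange_eq_one hs, F.rep_one]
  rfl

theorem IsSmoothField.lieField {ζ : VField m M} (hζ : IsSmoothVField ζ) {φ : M → W}
    (hφ : IsSmoothField F φ) : IsSmoothField F (lieField F ζ φ) := by
  intro x₀ y hy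
  have h1 := hφ.contDiffAt F hy
  have h2 := hζ.contDiffAt hy
  have h3 : ContDiffAt ℝ ∞ (lieCoord F (coordVec ζ x₀) (coordField F φ x₀)) y :=
    ((h1.fderiv_right (m := ∞) (by simp)).clm_apply h2).sub
      (((contDiffAt_const (c := fderiv ℝ F.rep 1)).clm_apply
        (h2.fderiv_right (m := ∞) (by simp))).clm_apply h1)
  refine (h3.congr_of_eventuallyEq ?_).contDiffWithinAt
  filter_upwards [extChartAt_target_nhds hy] with w hw
  exact coordField_lieField F hζ hφ hw

theorem coordField_add_smul (φ χ : M → W) (c : ℝ) (x₀ : M) (y : Euc m) :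
    coordField F (φ + c • χ) x₀ y = coordField F φ x₀ y + c • coordField F χ x₀ y := by
  simp [coordField]

theorem lieField_add_smul {φ χ : M → W} (hφ : IsSmoothField F φ) (hχ : IsSmoothField F χ)
    (ζ : VField m M) (c : ℝ) :
    CovPhase.lieField F ζ (φ + c • χ) = CovPhase.lieField F ζ φ + c • CovPhase.lieField F ζ χ := by
  funext x
  have hy := mem_extChartAt_target (I := 𝓡 m) x
  have h1 := (hφ.contDiffAt F hy).differentiableAt (by simp)
  have h2 := (hχ.contDiffAt F hy).differentiableAt (by simp)
  have h3 : fderiv ℝ (coordField F (φ + c • χ) x) (extChartAt (𝓡 m) x x)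
      = fderiv ℝ (coordField F φ x) (extChartAt (𝓡 m) x x)
        + c • fderiv ℝ (coordField F χ x) (extChartAt (𝓡 m) x x) := by
    rw [show coordField F (φ + c • χ) x = coordField F φ x + c • coordField F χ x from
      funext fun y => coordField_add_smul F φ χ c x y]
    exact (h1.hasFDerivAt.add (h2.hasFDerivAt.const_smul c)).fderiv
  simp only [CovPhase.lieField, h3, Pi.add_apply, Pi.smul_apply, map_add, map_smul,
    _root_.add_apply, _root_.smul_apply, smul_sub]
  abel

theorem lieField_zero (φ : M → W) : CovPhase.lieField F (0 : VField m M) φ = 0 := by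
  funext x
  have h : coordVec (0 : VField m M) x = fun _ => 0 := by
    funext y; simp [coordVec]
  simp [CovPhase.lieField, jacobian, h]

theorem IsSmoothField.smoothFamily {r : ℕ} {φ : M → W} (h : IsSmoothField F φ) :
    IsSmoothFamily F (fun _ : Euc r => φ) := fun x₀ =>
  (h x₀).comp contDiff_snd.contDiffOn fun _ hq => hq.2

theorem IsSmoothField.smoothFamily_add_smul {φ χ : M → W} (h : IsSmoothField F φ)
    (hχ : IsSmoothField F χ) :
    IsSmoothFamily F (fun q : Euc 1 => φ + q 0 • χ) := by
  intro x₀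
  simp only [coordField_add_smul]
  have h1 : ContDiffOn ℝ ∞ (fun q : Euc 1 × Euc m => q.1 0) (univ ×ˢ (extChartAt (𝓡 m) x₀).target) :=
    ((EuclideanSpace.proj (𝕜 := ℝ) (0 : Fin 1)).contDiff.comp
      contDiff_fst).contDiffOn
  exact (h.smoothFamily F x₀).add (h1.smul (hχ.smoothFamily F x₀))

/-- A smooth section with a prescribed value at a point. -/
theorem exists_isSmoothField_eq [T2Space M] (x : M) (w : W) :
    ∃ χ : M → W, IsSmoothField F χ ∧ χ x = w := by
  classical
  let f : SmoothBumpFunction (𝓡 m) x := Classical.arbitrary _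
  -- The section with constant components `w` in the chart at `x`, cut off by a bump function.
  -- Outside that chart the coordinate change has no meaning, but there the bump function vanishes.
  refine ⟨fun p => f p • F.rep (tangentCoordChange (𝓡 m) x p p) w, ?_, ?_⟩
  · intro x₀ y hy
    refine ContDiffAt.contDiffWithinAt ?_
    by_cases h : (extChartAt (𝓡 m) x₀).symm y ∈ (extChartAt (𝓡 m) x).source
    · have hf : ContDiffAt ℝ ∞ (f ∘ (extChartAt (𝓡 m) x₀).symm) y :=
        (f.contMDiff.contMDiffAt.comp y (contMDiffAt_extChartAt_symm hy)).contDiffAt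
      have ht : transition x₀ x y ∈ (extChartAt (𝓡 m) x).target :=
        (extChartAt (𝓡 m) x).map_source h
      have hty : (extChartAt (𝓡 m) x).symm (transition x₀ x y) = (extChartAt (𝓡 m) x₀).symm y :=
        (extChartAt (𝓡 m) x).left_inv h
      have hs := (extChartAt (𝓡 m) x₀).map_target hy
      have hu : IsUnit (fderiv ℝ (transition x x₀) (transition x₀ x y)) := by
        rw [fderiv_transition ht, hty]
        exact isUnit_tangentCoordChange h hs
      have hd : ContDiffAt ℝ ∞ (fun v => fderiv ℝ (transition x x₀) (transition x₀ x v)) y :=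
        ContDiffAt.comp y ((contDiffAt_transition ht (by rwa [hty])).fderiv_right (m := ∞) (by simp))
          (contDiffAt_transition hy h)
      have hr : ContDiffAt ℝ ∞
          (fun v => F.rep (fderiv ℝ (transition x x₀) (transition x₀ x v)) w) y :=
        (ContDiffAt.comp (g := F.rep) y (F.contDiffAt_rep hu) hd).clm_apply contDiffAt_const
      refine (hf.smul hr).congr_of_eventuallyEq ?_
      filter_upwards [eventually_mem_source hy h] with v hv
      have hvt : (extChartAt (𝓡 m) x).symm (transition x₀ x v) = (extChartAt (𝓡 m) x₀).symm v :=
        (extChartAt (𝓡 m) x).left_inv hv.2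
      have hvs := (extChartAt (𝓡 m) x₀).map_target hv.1
      simp only [coordField, map_smul, Pi.smul_apply', Function.comp_apply]
      rw [fderiv_transition (y := transition x₀ x v) ((extChartAt (𝓡 m) x).map_source hv.2), hvt,
        ← mul_apply_eq_comp, ← F.rep_mul _ _
          (isUnit_tangentCoordChange (mem_extChartAt_source _) hvs)
          (isUnit_tangentCoordChange hv.2 (mem_extChartAt_source _)),
        tangentCoordChange_mul hv.2 (mem_extChartAt_source _) hvs]
    · have hn : (extChartAt (𝓡 m) x₀).symm y ∉ tsupport f := fun hm =>
        h (by simpa using f.tsupport_subset_chartAt_source hm)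
      refine (contDiffAt_const (c := (0 : W))).congr_of_eventuallyEq ?_
      filter_upwards [(contMDiffAt_extChartAt_symm hy).continuousAt.eventually
        (notMem_tsupport_iff_eventuallyEq.1 hn)] with v hv
      have hv' : f ((extChartAt (𝓡 m) x₀).symm v) = 0 := hv
      simp only [coordField, hv', zero_smul, map_zero]
  · simp only [f.eq_one, one_smul, tangentCoordChange_eq_one (mem_extChartAt_source x), F.rep_one]
    rfl

end FieldCoordinates

/-! ### Local field-space forms: smoothness on spacetime and along lines of fields -/

section LocalForms

variable {m : ℕ} {W : Type*} [NormedAddCommGroup W] [NormedSpace ℝ W] {F : FieldType m W}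
  {M : Type*} [TopologicalSpace M] [ChartedSpace (Euc m) M] [IsManifold (𝓡 m) ∞ M] {p k : ℕ}
  {α : FSForm M W m M p k}

/-- The smoothness axiom for a family with zero-dimensional parameter space. -/
theorem IsLocalForm.smoothFormAt (hα : IsLocalForm F α) {φ : M → W} {χ : Fin p → M → W} {x : M}
    (hφ : IsSmoothField F φ) (hx : φ x ∈ F.adm) (hχ : ∀ i, IsSmoothField F (χ i)) :
    SmoothFormAt (α φ χ) x := by
  have h := hα.smooth 0 (fun _ => φ) (fun i _ => χ i) (hφ.smoothFamily F)
    (fun i => (hχ i).smoothFamily F) 0 x hx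
  exact ContDiffAt.comp (f := fun y : Euc m => ((0 : Euc 0), y)) (extChartAt (𝓡 m) x x) h
    (contDiffAt_const.prodMk contDiffAt_id)

/-- The smoothness axiom for the one-parameter family `φ + ε ψ`. It guarantees that the derivatives
in `fsD` are genuine ones. -/
theorem IsLocalForm.contDiffAt_line (hα : IsLocalForm F α) {φ ψ : M → W} {χ : Fin p → M → W}
    {x : M} (hφ : IsSmoothField F φ) (hx : φ x ∈ F.adm) (hψ : IsSmoothField F ψ)
    (hχ : ∀ i, IsSmoothField F (χ i)) :
    ContDiffAt ℝ ∞ (fun ε : ℝ => α (φ + ε • ψ) χ x) 0 := by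
  have h := hα.smooth 1 (fun q => φ + q 0 • ψ) (fun i _ => χ i) (hφ.smoothFamily_add_smul F hψ)
    (fun i => (hχ i).smoothFamily F) 0 x (by simpa using hx)
  have h2 : ContDiffAt ℝ ∞ (fun ε : ℝ => (ε • EuclideanSpace.single (0 : Fin 1) (1 : ℝ),
      extChartAt (𝓡 m) x x)) 0 := (contDiffAt_id.smul contDiffAt_const).prodMk contDiffAt_const
  have h3 := ContDiffAt.comp (f := fun ε : ℝ => (ε • EuclideanSpace.single (0 : Fin 1) (1 : ℝ),
      extChartAt (𝓡 m) x x)) (0 : ℝ) (by simpa using h) h2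
  refine h3.congr_of_eventuallyEq (Eventually.of_forall fun ε => ?_)
  simpa using (coordForm_self (α (φ + ε • ψ) χ) x).symm

theorem IsLocalForm.deriv_add {β : FSForm M W m M p k} (hα : IsLocalForm F α) (hβ : IsLocalForm F β)
    {φ ψ : M → W} {χ : Fin p → M → W} {x : M} (hφ : IsSmoothField F φ) (hx : φ x ∈ F.adm)
    (hψ : IsSmoothField F ψ) (hχ : ∀ i, IsSmoothField F (χ i)) :
    deriv (fun ε : ℝ => (α + β) (φ + ε • ψ) χ x) 0
      = deriv (fun ε : ℝ => α (φ + ε • ψ) χ x) 0 + deriv (fun ε : ℝ => β (φ + ε • ψ) χ x) 0 :=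
  _root_.deriv_add ((hα.contDiffAt_line hφ hx hψ hχ).differentiableAt (by simp))
    ((hβ.contDiffAt_line hφ hx hψ hχ).differentiableAt (by simp))

/-- In degree zero `L_V` is `I_V δ` and the contraction with `δξ` is an empty sum; hence only the
value `ξ φ` matters and field dependence of `ξ` is invisible. -/
theorem anomaly_zero_form_apply (ξ : (M → W) → VField m M) (γ : FSForm M W m M 0 k) (φ : M → W)
    (x : M) :
    anomaly F ξ γ φ ![] x
      = deriv (fun ε : ℝ => γ (φ + ε • lieField F (ξ φ) φ) ![] x) 0 - lieForm (ξ φ) (γ φ ![]) x := by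
  have h : ∀ χ : Fin 0 → M → W, χ = ![] := fun χ => Subsingleton.elim _ _
  simp [anomaly, fsLie, fsContract, fsD, stLie, fsContractOne, hat, h]

end LocalForms

/-! ### Derivatives of curves of linear maps -/

section Calculus

variable {A B : Type*} [NormedAddCommGroup A] [NormedSpace ℝ A] [NormedAddCommGroup B]
  [NormedSpace ℝ B]

theorem deriv_clm_eq_zero {f : ℝ → A →L[ℝ] B} {t : ℝ}
    (h : ∀ w, deriv (fun ε => f ε w) t = 0) : deriv f t = 0 := by
  by_cases hd : DifferentiableAt ℝ f t
  · ext1 w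
    have := (hd.hasDerivAt.clm_apply (hasDerivAt_const t w)).deriv
    rw [h w] at this
    simpa using this.symm
  -- Without differentiability `deriv` takes its default value 0, so the claim holds in either case.
  · exact deriv_zero_of_not_differentiableAt hd

theorem deriv_clm_apply_add_smul {f : ℝ → A →L[ℝ] B} {u v : A}
    (hu : DifferentiableAt ℝ (fun ε => f ε u) 0) (hv : DifferentiableAt ℝ (fun ε => f ε v) 0) :
    deriv (fun ε : ℝ => f ε (u + ε • v)) 0 = deriv (fun ε => f ε u) 0 + f 0 v := by
  simp only [map_add, map_smul]
  have h : HasDerivAt (fun ε : ℝ => f ε u + ε • f ε v) _ 0 :=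
    hu.hasDerivAt.add ((hasDerivAt_id (0 : ℝ)).smul hv.hasDerivAt)
  exact h.deriv.trans (by simp)

end Calculus

/-! ### Lie derivatives as tangent vectors of the solution space, and `dh_ξ` -/

section ChargeDensity

variable {n : ℕ} {W : Type*} [NormedAddCommGroup W] [NormedSpace ℝ W]
  {F : FieldType (n + 2) W}
  {M : Type*} [TopologicalSpace M] [ChartedSpace (Euc (n + 2)) M] [IsManifold (𝓡 (n + 2)) ∞ M]
  (T : Theory F M) {U : Set M}

/-- The linearization of the field equations along a Lie derivative vanishes on solutions. -/
theorem isTangent_lieField [T2Space M] (hU : IsOpen U) {ζ : VField (n + 2) M}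
    (hζ : IsSmoothVField ζ) {φ : M → W} (hφ : IsSolution T U φ) :
    IsTangent T U φ (lieField F ζ φ) := by
  obtain ⟨⟨hφs, hadm⟩, hE⟩ := hφ
  have hV : IsSmoothField F (lieField F ζ φ) := hφs.lieField F hζ
  refine ⟨hV, fun x hx => ?_⟩
  -- The linearized equation is tested on each `w : W`, realized as the value at `x` of a smooth
  -- variation `χ`, to which the invariance of `E · δφ` applies.
  refine deriv_clm_eq_zero (A := W) (B := (Euc (n + 2)) [⋀^Fin (n + 2)]→L[ℝ] ℝ) fun w => ?_
  obtain ⟨χ, hχ, rfl⟩ := exists_isSmoothField_eq F x w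
  have h := congrFun (T.invariant_E ζ hζ φ ⟨hφs, hadm⟩ (fun _ => χ) fun _ => hχ) x
  have hdiff : ∀ ψ : M → W, IsSmoothField F ψ →
      DifferentiableAt ℝ (fun ε : ℝ => T.E (φ + ε • χ) x (ψ x)) 0 := fun ψ hψ =>
    (T.local_E.contDiffAt_line (χ := fun _ => ψ) hφs (hadm x) hχ fun _ => hψ).differentiableAt
      (by simp)
  -- The field equations hold on the open set `U`, so the form vanishes near `x` and its Lie
  -- derivative vanishes at `x`.
  have hlie : lieForm ζ (fun p => T.E φ p (χ p)) x = 0 := by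
    have h0 : coordForm (fun p => T.E φ p (χ p)) x
        =ᶠ[𝓝 (extChartAt (𝓡 (n + 2)) x x)] fun _ => 0 := by
      have hy := mem_extChartAt_target (I := 𝓡 (n + 2)) x
      filter_upwards [(contMDiffAt_extChartAt_symm hy).continuousAt.preimage_mem_nhds
        (hU.mem_nhds (by simpa using hx))] with y hy
      have : T.E φ ((extChartAt (𝓡 (n + 2)) x).symm y) = 0 := hE _ hy
      simp only [coordForm, this]
      rfl
    have h1 : T.E φ x (χ x) = 0 := by rw [hE x hx]; rfl
    rw [lieForm, h0.fderiv_eq, h1, deriv_compContinuousLinearMap_id_add_smul]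
    ext v
    simp
  -- By the product rule the two sides differ by `E_φ(£_ζ χ)`, which is zero on shell.
  have hprod : deriv (fun ε : ℝ => T.E (φ + ε • χ) x (lieField F ζ (φ + ε • χ) x)) 0
      = deriv (fun ε : ℝ => T.E (φ + ε • χ) x (lieField F ζ φ x)) 0 := by
    simp only [lieField_add_smul F hφs hχ, Pi.add_apply, Pi.smul_apply]
    rw [deriv_clm_apply_add_smul (A := W) (B := (Euc (n + 2)) [⋀^Fin (n + 2)]→L[ℝ] ℝ)
      (f := fun ε : ℝ => T.E (φ + ε • χ) x) (hdiff _ hV) (hdiff _ (hχ.lieField F hζ)),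
      zero_smul, add_zero, hE x hx]
    exact add_zero _
  -- The vector field `ζ` is fixed, so `δζ = 0`.
  have hν : fsContractOne (hatVariation F fun _ => ζ) (eomForm T.E) φ (fun _ => χ) x = 0 := by
    have h0 : hatVariation F (fun _ => ζ) φ χ = 0 := by
      rw [← lieField_zero F φ, hatVariation]
      congr 1
      funext y
      simp
    simp [fsContractOne, h0, eomForm]
  have hst : stLie (fun _ => ζ) (eomForm T.E) φ (fun _ => χ) x = 0 := hlie
  -- Of the three terms of `I_V δ + δ I_V`, the two derivatives along `χ` cancel by `hprod`; only
  -- the derivative of `E` along `£_ζ φ` survives.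
  have hL : fsLie (hat F fun _ => ζ) (eomForm T.E) φ (fun _ => χ) x
      = deriv (fun ε : ℝ => T.E (φ + ε • lieField F ζ φ) x (χ x)) 0 := by
    have h1 : fsContract (hat F fun _ => ζ) (fsD (eomForm T.E)) φ (fun _ => χ) x
        = deriv (fun ε : ℝ => T.E (φ + ε • lieField F ζ φ) x (χ x)) 0
          - deriv (fun ε : ℝ => T.E (φ + ε • χ) x (lieField F ζ φ x)) 0 := by
      simp [fsContract, fsD, eomForm, hat, Fin.sum_univ_two, Fin.removeNth, sub_eq_add_neg]
      ext v
      simp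
    have h2 : fsD (fsContract (hat F fun _ => ζ) (eomForm T.E)) φ (fun _ => χ) x
        = deriv (fun ε : ℝ => T.E (φ + ε • χ) x (lieField F ζ (φ + ε • χ) x)) 0 := by
      simp [fsContract, fsD, eomForm, hat]
    rw [fsLie, Pi.add_apply, Pi.add_apply, Pi.add_apply, h1, h2, hprod, sub_add_cancel]
  have hA : anomaly F (fun _ => ζ) (eomForm T.E) φ (fun _ => χ) x
      = fsLie (hat F fun _ => ζ) (eomForm T.E) φ (fun _ => χ) x
        - stLie (fun _ => ζ) (eomForm T.E) φ (fun _ => χ) x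
        - fsContractOne (hatVariation F fun _ => ζ) (eomForm T.E) φ (fun _ => χ) x := rfl
  rw [← hL]
  rw [hA, hst, hν, sub_zero, sub_zero] at h
  exact h

theorem fsD_zero_form_apply {m k : ℕ} (γ : FSForm M W m M 0 k) (φ V : M → W) (x : M) :
    fsD γ φ (Fin.cons V ![]) x = deriv (fun ε : ℝ => γ (φ + ε • V) ![] x) 0 := by
  have h : ∀ χ : Fin 0 → M → W, χ = ![] := fun χ => Subsingleton.elim _ _
  simp [fsD, h]

variable {N : Type*} [TopologicalSpace N] [ChartedSpace (Euc (n + 1)) N]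
  [IsManifold (𝓡 (n + 1)) ∞ N] {ℓ : FSForm M W (n + 2) M 0 (n + 1)}
  {β : FSForm M W (n + 2) M 1 n} {Q : VField (n + 2) M → FSForm M W (n + 2) M 0 n}

theorem isSmoothForm_chargeDensity (hℓ : IsLocalForm F ℓ) (hβ : IsLocalForm F β)
    (hQ : IsNoetherPotential T U Q) {ξ : (M → W) → VField (n + 2) M} {φ : M → W}
    (hφ : IsSolution T U φ) (hξ : IsSmoothVField (ξ φ)) :
    IsSmoothForm (chargeDensity T Q ℓ β ξ φ ![]) := by
  have hV := hφ.1.1.lieField F hξ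
  have hc : ∀ i : Fin 1, IsSmoothField F ((Fin.cons (lieField F (ξ φ) φ) ![] : Fin 1 → M → W) i) := by
    intro i; obtain rfl := Fin.eq_zero i; exact hV
  rw [isSmoothForm_iff]
  intro x
  exact (((((hQ _ hξ φ hφ ![]).1.smoothFormAt x).add
    ((T.local_b.smoothFormAt hφ.1.1 (hφ.1.2 x) nofun).curryLeft hξ)).add
    (T.local_lam.smoothFormAt hφ.1.1 (hφ.1.2 x) hc)).add
    ((hℓ.smoothFormAt hφ.1.1 (hφ.1.2 x) nofun).curryLeft hξ)).sub
    (hβ.smoothFormAt hφ.1.1 (hφ.1.2 x) hc)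

/-- The exterior derivative of the charge density on the hypersurface. -/
theorem stD_chargeDensity [T2Space M] (hU : IsOpen U) {ι : N → M}
    (hι : ContMDiff (𝓡 (n + 1)) (𝓡 (n + 2)) ∞ ι) (hιU : range ι ⊆ frontier U)
    (hℓ : IsLocalForm F ℓ) (hβ : IsLocalForm F β) {ℰ : FSForm M W (n + 1) N 1 (n + 1)}
    (hdec : IsBoundaryDecomposition T U ι ℓ β ℰ) (hQ : IsNoetherPotential T U Q)
    {ξ : (M → W) → VField (n + 2) M} {φ : M → W}
    (hφ : IsSolution T U φ) (hξ : IsSmoothVField (ξ φ)) :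
    stD (stPullback ι (chargeDensity T Q ℓ β ξ)) φ ![]
      = fsContract (hat F ξ) ℰ φ ![] - stPullback ι (anomaly F ξ (ℓ + T.b)) φ ![]
        - stPullback ι (stContract ξ (T.L + stD ℓ)) φ ![] := by
  set V := lieField F (ξ φ) φ with hVdef
  have hV : IsSmoothField F V := hφ.1.1.lieField F hξ
  set c : Fin 1 → M → W := Fin.cons V ![] with hcdef
  have hc : ∀ i : Fin 1, IsSmoothField F (c i) := by
    intro i; obtain rfl := Fin.eq_zero i; exact hV
  -- The decomposition of the symplectic potential holds only for tangent vectors of the solution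
  -- space; this permits its contraction with `ξ̂`.
  have hct : ∀ i : Fin 1, IsTangent T U φ (c i) := by
    intro i; obtain rfl := Fin.eq_zero i; exact isTangent_lieField T hU hξ hφ
  funext q
  have hadm := hφ.1.2 (ι q)
  have sℓ := hℓ.smoothFormAt (χ := ![]) hφ.1.1 hadm nofun
  have sb := T.local_b.smoothFormAt (χ := ![]) hφ.1.1 hadm nofun
  have slam := T.local_lam.smoothFormAt (χ := c) hφ.1.1 hadm hc
  have sβ := hβ.smoothFormAt (χ := c) hφ.1.1 hadm hc
  have sQ := (hQ _ hξ φ hφ ![]).1.smoothFormAt (ι q)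
  -- The hypersurface misses the open set `U`; the Noether identity is available on it because it
  -- holds up to the closure.
  have hcl : ι q ∈ closure U := frontier_subset_closure (hιU (mem_range_self q))
  have eQ : extD (Q (ξ φ) φ ![]) (ι q) = T.θ φ c (ι q) - fsD T.b φ c (ι q) - extD (T.lam φ c) (ι q)
      - (T.L φ ![] (ι q) - extD (T.b φ ![]) (ι q)).curryLeft (ξ φ (ι q)) :=
    (hQ _ hξ φ hφ ![]).2 _ hcl
  have eh : extD (chargeDensity T Q ℓ β ξ φ ![]) (ι q)
      = extD (Q (ξ φ) φ ![]) (ι q) + extD (fun x => (T.b φ ![] x).curryLeft (ξ φ x)) (ι q)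
        + extD (T.lam φ c) (ι q) + extD (fun x => (ℓ φ ![] x).curryLeft (ξ φ x)) (ι q)
        - extD (β φ c) (ι q) := by
    rw [← extD_add sQ (sb.curryLeft hξ), ← extD_add (sQ.add (sb.curryLeft hξ)) slam,
      ← extD_add ((sQ.add (sb.curryLeft hξ)).add slam) (sℓ.curryLeft hξ),
      ← extD_sub (((sQ.add (sb.curryLeft hξ)).add slam).add (sℓ.curryLeft hξ)) sβ]
    rfl
  have edec : pullback (r := n + 1) ι (T.θ φ c) q
      = - pullback (r := n + 1) ι (fsD ℓ φ c) q + extD (pullback (r := n + 1) ι (β φ c)) q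
        + ℰ φ c q := congrFun (hdec φ hφ c hct) q
  have ean : anomaly F ξ (ℓ + T.b) φ ![] (ι q)
      = fsD ℓ φ c (ι q) + fsD T.b φ c (ι q)
        - (extD (fun x => (ℓ φ ![] x).curryLeft (ξ φ x)) (ι q)
          + extD (fun x => (T.b φ ![] x).curryLeft (ξ φ x)) (ι q)
          + (extD (ℓ φ ![]) (ι q) + extD (T.b φ ![]) (ι q)).curryLeft (ξ φ (ι q))) := by
    rw [anomaly_zero_form_apply, fsD_zero_form_apply, fsD_zero_form_apply,
      hℓ.deriv_add T.local_b hφ.1.1 hadm hV nofun,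
      show (ℓ + T.b) φ ![] = ℓ φ ![] + T.b φ ![] from rfl, lieForm_eq (sℓ.add sb) hξ,
      extD_add sℓ sb, ← extD_add (sℓ.curryLeft hξ) (sb.curryLeft hξ)]
    rfl
  have e1 : stD (stPullback ι (chargeDensity T Q ℓ β ξ)) φ ![] q
      = pullback (r := n + 1) ι (extD (chargeDensity T Q ℓ β ξ φ ![])) q :=
    extD_pullback hι ((isSmoothForm_chargeDensity T hℓ hβ hQ hφ hξ).smoothFormAt _)
  rw [extD_pullback hι sβ] at edec
  -- Pullback at the single point `q`, as a linear map: the rest is linear algebra.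
  let P : (Euc (n + 2) [⋀^Fin (n + 1)]→L[ℝ] ℝ) →ₗ[ℝ] (Euc (n + 1) [⋀^Fin (n + 1)]→L[ℝ] ℝ) :=
    { toFun := fun a => a.compContinuousLinearMap
        (mfderiv (𝓡 (n + 1)) (𝓡 (n + 2)) ι q : Euc (n + 1) →L[ℝ] Euc (n + 2))
      map_add' := fun _ _ => rfl
      map_smul' := fun _ _ => rfl }
  have hsub : ∀ (a b : Euc (n + 2) [⋀^Fin (n + 2)]→L[ℝ] ℝ) (v : Euc (n + 2)),
      (a - b).curryLeft v = a.curryLeft v - b.curryLeft v := fun a b v => by ext; simp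
  -- The terms `dλ'` cancel between `Q_ξ` and `I_ξ̂ λ'`, the terms `dβ'` between `θ'` and `I_ξ̂ β'`.
  -- The terms in `ℓ'` and `b'` make up the anomaly, except that its `i_ξ dℓ'` has to be
  -- compensated, which puts `dℓ'` next to `L'`.
  have e2 : P (extD (chargeDensity T Q ℓ β ξ φ ![]) (ι q)) = ℰ φ c q
      - P (anomaly F ξ (ℓ + T.b) φ ![] (ι q))
      - P ((T.L φ ![] (ι q) + extD (ℓ φ ![]) (ι q)).curryLeft (ξ φ (ι q))) := by
    have edec' : P (T.θ φ c (ι q)) = - P (fsD ℓ φ c (ι q)) + P (extD (β φ c) (ι q)) + ℰ φ c q :=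
      edec
    rw [eh, eQ, ean]
    simp only [hsub, map_add, map_sub, ContinuousAlternatingMap.curryLeft_add, add_apply, edec']
    abel
  rw [e1]
  exact e2

end ChargeDensity

/-! ### Top forms in charts -/

section TopForms

variable {n : ℕ}

theorem compContinuousLinearMap_single (α : (Euc n) [⋀^Fin n]→L[ℝ] ℝ) (A : Euc n →L[ℝ] Euc n) :
    α.compContinuousLinearMap A (fun j => EuclideanSpace.single j (1 : ℝ))
      = A.det * α (fun j => EuclideanSpace.single j (1 : ℝ)) := by
  let b := (EuclideanSpace.basisFun (Fin n) ℝ).toBasis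
  have hb : (fun j => EuclideanSpace.single j (1 : ℝ)) = b := by
    funext j; simp [b]
  have h1 : ∀ v, α v = α b * b.det v := fun v =>
    congrArg (fun f : (Euc n) [⋀^Fin n]→ₗ[ℝ] ℝ => f v) (α.toAlternatingMap.eq_smul_basis_det b)
  have h2 : b.det (A ∘ b) = A.det * b.det b := b.det_comp (A : Euc n →ₗ[ℝ] Euc n) b
  rw [hb]
  calc α (A ∘ b) = α b * b.det (A ∘ b) := h1 _
    _ = A.det * α b := by rw [h2, b.det_self]; ring

theorem apply_single_ne_zero {α : (Euc n) [⋀^Fin n]→L[ℝ] ℝ} (h : α ≠ 0) :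
    α (fun j => EuclideanSpace.single j (1 : ℝ)) ≠ 0 := by
  let b := (EuclideanSpace.basisFun (Fin n) ℝ).toBasis
  have hb : (fun j => EuclideanSpace.single j (1 : ℝ)) = b := by
    funext j; simp [b]
  rw [hb]
  refine (α.toAlternatingMap.map_basis_ne_zero_iff b).2 fun h0 => h ?_
  ext v
  exact congrArg (fun f : (Euc n) [⋀^Fin n]→ₗ[ℝ] ℝ => f v) h0

theorem det_ne_zero_of_isUnit {A : Euc n →L[ℝ] Euc n} (h : IsUnit A) : A.det ≠ 0 := by
  obtain ⟨u, rfl⟩ := h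
  have h1 : LinearMap.det (((u : Euc n →L[ℝ] Euc n) : Euc n →ₗ[ℝ] Euc n) ∘ₗ
      ((↑u⁻¹ : Euc n →L[ℝ] Euc n) : Euc n →ₗ[ℝ] Euc n)) = 1 := by
    rw [← LinearMap.det_id (A := ℝ) (M := Euc n)]
    congr 1
    ext1 v
    exact congrArg (fun B : Euc n →L[ℝ] Euc n => B v) u.mul_inv
  rw [LinearMap.det_comp] at h1
  exact left_ne_zero_of_mul_eq_one h1

/-- For `d` the Jacobian determinant of a transition map: the orientation sign turns the factor `d`
in the coefficient of a top form into the `|d|` of the change of variables formula. -/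
theorem sign_mul_mul {d : ℝ} (hd : d ≠ 0) (a b : ℝ) :
    Real.sign (d * a) * (d * b) = |d| * (Real.sign a * b) := by
  rcases lt_or_gt_of_ne hd with h | h <;> rcases lt_trichotomy a 0 with ha | rfl | ha
  · rw [Real.sign_of_pos (mul_pos_of_neg_of_neg h ha), Real.sign_of_neg ha, abs_of_neg h]; ring
  · simp
  · rw [Real.sign_of_neg (mul_neg_of_neg_of_pos h ha), Real.sign_of_pos ha, abs_of_neg h]; ring
  · rw [Real.sign_of_neg (mul_neg_of_pos_of_neg h ha), Real.sign_of_neg ha, abs_of_pos h]; ring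
  · simp
  · rw [Real.sign_of_pos (mul_pos h ha), Real.sign_of_pos ha, abs_of_pos h]; ring

variable {k : ℕ} {S : Type*} [TopologicalSpace S] [ChartedSpace (Euc n) S] [IsManifold (𝓡 n) ∞ S]

theorem coordForm_transition (α : DForm n S k) {i j : S} {y : Euc n}
    (hy : y ∈ (extChartAt (𝓡 n) i).target)
    (hj : (extChartAt (𝓡 n) i).symm y ∈ (extChartAt (𝓡 n) j).source) :
    coordForm α i y = (coordForm α j (transition i j y)).compContinuousLinearMap
      (fderiv ℝ (transition i j) y) := by
  rw [coordForm_eq_pb α hy, pb_eq_coordForm α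
    ((contMDiffAt_extChartAt_symm hy).mdifferentiableAt (by simp)) hj]
  rfl

theorem topCoeff_transition (α : DForm n S n) {i j : S} {y : Euc n}
    (hy : y ∈ (extChartAt (𝓡 n) i).target)
    (hj : (extChartAt (𝓡 n) i).symm y ∈ (extChartAt (𝓡 n) j).source) :
    topCoeff α i y = (fderiv ℝ (transition i j) y).det * topCoeff α j (transition i j y) := by
  rw [topCoeff, coordForm_transition α hy hj, compContinuousLinearMap_single]
  rfl

theorem coordForm_eq_zero {α : DForm n S k} {i : S} {y : Euc n}
    (h : α ((extChartAt (𝓡 n) i).symm y) = 0) : coordForm α i y = 0 := by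
  simp only [coordForm, h]
  rfl

theorem topCoeff_eq_zero {α : DForm n S n} {i : S} {y : Euc n}
    (h : α ((extChartAt (𝓡 n) i).symm y) = 0) : topCoeff α i y = 0 := by
  rw [topCoeff, coordForm_eq_zero h]
  rfl

theorem topCoeff_ne_zero {α : DForm n S n} {i : S} {y : Euc n}
    (hy : y ∈ (extChartAt (𝓡 n) i).target)
    (h : α ((extChartAt (𝓡 n) i).symm y) ≠ 0) : topCoeff α i y ≠ 0 := by
  rw [topCoeff, coordForm, compContinuousLinearMap_single]
  exact mul_ne_zero (det_ne_zero_of_isUnit (isUnit_tangentCoordChange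
    ((extChartAt (𝓡 n) i).map_target hy) (mem_extChartAt_source _))) (apply_single_ne_zero h)

theorem contDiffAt_topCoeff {α : DForm n S n} (hα : IsSmoothForm α) {i : S} {y : Euc n}
    (hy : y ∈ (extChartAt (𝓡 n) i).target) : ContDiffAt ℝ ∞ (topCoeff α i) y :=
  contDiffAt_alternating_iff.1 (contDiffAt_coordForm hy (hα.smoothFormAt _)) _

/-- The sign, relative to the chart at `i`, of the orientation defined by `o`. -/
def orientSign (o : DForm n S n) (i : S) (y : Euc n) : ℝ := Real.sign (topCoeff o i y)

/-- The coefficient of `o` is continuous and nowhere zero, so its sign is locally constant. This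
lets the sign pass through derivatives. -/
theorem orientSign_eventually_eq {o : DForm n S n} (ho : IsSmoothForm o) (ho₀ : ∀ x, o x ≠ 0)
    {i : S} {y : Euc n} (hy : y ∈ (extChartAt (𝓡 n) i).target) :
    ∀ᶠ w in 𝓝 y, orientSign o i w = orientSign o i y := by
  have hc := (contDiffAt_topCoeff ho hy).continuousAt
  rcases lt_or_gt_of_ne (topCoeff_ne_zero hy (ho₀ _)) with h | h
  · filter_upwards [hc.eventually_lt continuousAt_const h] with w hw
    rw [orientSign, orientSign, Real.sign_of_neg hw, Real.sign_of_neg h]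
  · filter_upwards [continuousAt_const.eventually_lt hc h] with w hw
    rw [orientSign, orientSign, Real.sign_of_pos hw, Real.sign_of_pos h]

theorem continuousAt_orientSign {o : DForm n S n} (ho : IsSmoothForm o) (ho₀ : ∀ x, o x ≠ 0)
    {i : S} {y : Euc n} (hy : y ∈ (extChartAt (𝓡 n) i).target) :
    ContinuousAt (orientSign o i) y :=
  continuousAt_const.congr ((orientSign_eventually_eq ho ho₀ hy).mono fun _ h => h.symm)

/-- The integral over a chart domain of an oriented top form that vanishes off another chart domain
does not depend on the chart. -/
theorem setIntegral_chart_eq (o : DForm n S n) {κ : DForm n S n} {i j : S}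
    (hκ : ∀ x, κ x ≠ 0 → x ∈ (extChartAt (𝓡 n) i).source ∧ x ∈ (extChartAt (𝓡 n) j).source) :
    ∫ y in (extChartAt (𝓡 n) i).target, orientSign o i y * topCoeff κ i y
      = ∫ y in (extChartAt (𝓡 n) j).target, orientSign o j y * topCoeff κ j y := by
  -- `D a b` is the overlap of the two chart domains, seen in the chart at `a`.
  set D : S → S → Set (Euc n) := fun a b =>
    (extChartAt (𝓡 n) a).target ∩ (extChartAt (𝓡 n) a).symm ⁻¹' (extChartAt (𝓡 n) b).source with hD
  have hDo : ∀ a b, IsOpen (D a b) := fun a b =>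
    (continuousOn_extChartAt_symm a).isOpen_inter_preimage (isOpen_extChartAt_target a)
      (isOpen_extChartAt_source b)
  have hres : ∀ a b, (∀ x, κ x ≠ 0 → x ∈ (extChartAt (𝓡 n) b).source) →
      ∫ y in (extChartAt (𝓡 n) a).target, orientSign o a y * topCoeff κ a y
        = ∫ y in D a b, orientSign o a y * topCoeff κ a y := by
    intro a b hb
    refine setIntegral_eq_of_subset_of_forall_sdiff_eq_zero (isOpen_extChartAt_target a).measurableSet
      inter_subset_left fun y hy => ?_
    rw [topCoeff_eq_zero, mul_zero]
    by_contra h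
    exact hy.2 ⟨hy.1, hb _ h⟩
  have hmaps : ∀ a b, ∀ y ∈ D a b, transition a b y ∈ D b a ∧ transition b a (transition a b y) = y := by
    intro a b y hy
    have h1 : (extChartAt (𝓡 n) b).symm (transition a b y) = (extChartAt (𝓡 n) a).symm y :=
      (extChartAt (𝓡 n) b).left_inv hy.2
    refine ⟨⟨(extChartAt (𝓡 n) b).map_source hy.2, ?_⟩, ?_⟩
    · rw [mem_preimage, h1]
      exact (extChartAt (𝓡 n) a).map_target hy.1
    · rw [transition, Function.comp_apply, h1]
      exact (extChartAt (𝓡 n) a).right_inv hy.1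
  have himg : transition i j '' D i j = D j i := by
    refine Subset.antisymm ?_ fun y hy => ?_
    · rintro _ ⟨y, hy, rfl⟩
      exact (hmaps i j y hy).1
    · exact ⟨transition j i y, (hmaps j i y hy).1, (hmaps j i y hy).2⟩
  have hinj : InjOn (transition i j) (D i j) := fun y hy z hz h => by
    rw [← (hmaps i j y hy).2, ← (hmaps i j z hz).2, h]
  rw [hres i j fun x hx => (hκ x hx).2, hres j i fun x hx => (hκ x hx).1, ← himg,
    integral_image_eq_integral_abs_det_fderiv_smul volume (hDo i j).measurableSet
      (f' := fderiv ℝ (transition i j)) (fun y hy =>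
        (((contDiffAt_transition hy.1 hy.2).differentiableAt (by simp)).hasFDerivAt).hasFDerivWithinAt)
      hinj]
  refine setIntegral_congr_fun (hDo i j).measurableSet fun y hy => ?_
  have hd : (fderiv ℝ (transition i j) y).det ≠ 0 := by
    refine det_ne_zero_of_isUnit ?_
    rw [fderiv_transition hy.1]
    exact isUnit_tangentCoordChange ((extChartAt (𝓡 n) i).map_target hy.1) hy.2
  simp only [orientSign, smul_eq_mul]
  rw [topCoeff_transition o hy.1 hy.2, topCoeff_transition κ hy.1 hy.2, sign_mul_mul hd]

/-- The chart image of `K` is compact inside the target; `f` is continuous there and zero on the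
rest of the target. -/
theorem integrableOn_extChartAt_target {i : S} {K : Set S} (hK : IsCompact K)
    (hKs : K ⊆ (extChartAt (𝓡 n) i).source) {f : Euc n → ℝ}
    (hf : ContinuousOn f (extChartAt (𝓡 n) i).target)
    (h₀ : ∀ y ∈ (extChartAt (𝓡 n) i).target, (extChartAt (𝓡 n) i).symm y ∉ K → f y = 0) :
    IntegrableOn f (extChartAt (𝓡 n) i).target := by
  have hK' : IsCompact (extChartAt (𝓡 n) i '' K) :=
    hK.image_of_continuousOn ((continuousOn_extChartAt i).mono hKs)
  have hsub : extChartAt (𝓡 n) i '' K ⊆ (extChartAt (𝓡 n) i).target := by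
    rintro _ ⟨x, hx, rfl⟩
    exact (extChartAt (𝓡 n) i).map_source (hKs hx)
  refine ((hf.mono hsub).integrableOn_compact hK').of_forall_sdiff_eq_zero
    (isOpen_extChartAt_target i).measurableSet fun y hy => h₀ y hy.1 fun hm => hy.2 ?_
  exact ⟨_, hm, (extChartAt (𝓡 n) i).right_inv hy.1⟩

end TopForms

/-! ### Integration over a closed manifold -/

section ClosedManifold

variable {n : ℕ} {S : Type*} [TopologicalSpace S] [ChartedSpace (Euc n) S]
  [IsManifold (𝓡 n) ∞ S] [CompactSpace S] [T2Space S]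

theorem tsupport_chartPartition_subset (i : S) :
    tsupport (chartPartition n S i) ⊆ (extChartAt (𝓡 n) i).source := by
  rw [extChartAt_source]
  exact Classical.choose_spec
    (SmoothPartitionOfUnity.exists_isSubordinate_chartAt_source (𝓡 n) S) i

theorem isCompact_tsupport_chartPartition (i : S) : IsCompact (tsupport (chartPartition n S i)) :=
  (isClosed_tsupport _).isCompact

/-- On a compact space a locally finite family of supports has only finitely many nonempty members,
so the partition is indexed by a finite set of charts, independent of the point. -/
theorem exists_finset_chartPartition (n : ℕ) (S : Type*) [TopologicalSpace S]
    [ChartedSpace (Euc n) S] [IsManifold (𝓡 n) ∞ S] [CompactSpace S] [T2Space S] :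
    ∃ I : Finset S, (∀ i, i ∉ I → ∀ x, chartPartition n S i x = 0) ∧
      ∀ x, ∑ i ∈ I, chartPartition n S i x = 1 := by
  have hf := (chartPartition n S).locallyFinite.finite_nonempty_of_compact
  have h0 : ∀ i, i ∉ hf.toFinset → ∀ x, chartPartition n S i x = 0 := by
    intro i hi x
    by_contra hx
    exact hi (hf.mem_toFinset.2 ⟨x, hx⟩)
  refine ⟨hf.toFinset, h0, fun x => ?_⟩
  rw [← (chartPartition n S).sum_eq_one (mem_univ x), finsum_eq_sum_of_support_subset]
  intro i hi
  by_contra h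
  exact hi (h0 i h x)

/-- The finite set of charts that contribute to the partition of unity. -/
def chartIndex (n : ℕ) (S : Type*) [TopologicalSpace S]
    [ChartedSpace (Euc n) S] [IsManifold (𝓡 n) ∞ S] [CompactSpace S] [T2Space S] : Finset S :=
  Classical.choose (exists_finset_chartPartition n S)

theorem chartPartition_eq_zero {i : S} (hi : i ∉ chartIndex n S) (x : S) :
    chartPartition n S i x = 0 :=
  (Classical.choose_spec (exists_finset_chartPartition n S)).1 i hi x

theorem sum_chartPartition (x : S) : ∑ i ∈ chartIndex n S, chartPartition n S i x = 1 :=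
  (Classical.choose_spec (exists_finset_chartPartition n S)).2 x

theorem formIntegral_eq_sum (o α : DForm n S n) :
    formIntegral o α = ∑ i ∈ chartIndex n S, ∫ y in (extChartAt (𝓡 n) i).target,
      chartPartition n S i ((extChartAt (𝓡 n) i).symm y) * (orientSign o i y * topCoeff α i y) := by
  refine finsum_eq_sum_of_support_subset _ fun i hi => ?_
  by_contra h
  refine hi ?_
  simp only [chartPartition_eq_zero h]
  simp

theorem contDiffAt_chartPartition (j : S) {i : S} {y : Euc n}
    (hy : y ∈ (extChartAt (𝓡 n) i).target) :
    ContDiffAt ℝ ∞ (fun w => chartPartition n S j ((extChartAt (𝓡 n) i).symm w)) y :=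
  ((chartPartition n S j).contMDiff.contMDiffAt.comp y (contMDiffAt_extChartAt_symm hy)).contDiffAt

theorem chartPartition_eq_zero_of_notMem {j x : S}
    (h : x ∉ tsupport (chartPartition n S j)) : chartPartition n S j x = 0 :=
  image_eq_zero_of_notMem_tsupport h

section Oriented

variable {o : DForm n S n} (ho : IsSmoothForm o) (ho₀ : ∀ x, o x ≠ 0)

include ho ho₀

theorem continuousOn_chart_integrand (j i : S) {f : Euc n → ℝ}
    (hf : ContinuousOn f (extChartAt (𝓡 n) i).target) :
    ContinuousOn (fun y => chartPartition n S j ((extChartAt (𝓡 n) i).symm y)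
      * (orientSign o i y * f y)) (extChartAt (𝓡 n) i).target := fun y hy =>
  ((contDiffAt_chartPartition j hy).continuousAt.continuousWithinAt).mul
    ((continuousAt_orientSign ho ho₀ hy).continuousWithinAt.mul (hf y hy))

theorem integrableOn_chart_integrand (i : S) {f : Euc n → ℝ}
    (hf : ContinuousOn f (extChartAt (𝓡 n) i).target) :
    IntegrableOn (fun y => chartPartition n S i ((extChartAt (𝓡 n) i).symm y)
      * (orientSign o i y * f y)) (extChartAt (𝓡 n) i).target := by
  refine integrableOn_extChartAt_target (isCompact_tsupport_chartPartition i)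
    (tsupport_chartPartition_subset i) (continuousOn_chart_integrand ho ho₀ i i hf) fun y _ h => ?_
  rw [chartPartition_eq_zero_of_notMem h, zero_mul]

theorem formIntegral_add {α β : DForm n S n} (hα : IsSmoothForm α) (hβ : IsSmoothForm β) :
    formIntegral o (α + β) = formIntegral o α + formIntegral o β := by
  simp only [formIntegral_eq_sum, ← Finset.sum_add_distrib]
  refine Finset.sum_congr rfl fun i _ => ?_
  rw [← integral_add
    (integrableOn_chart_integrand ho ho₀ i fun y hy =>
      (contDiffAt_topCoeff hα hy).continuousAt.continuousWithinAt)
    (integrableOn_chart_integrand ho ho₀ i fun y hy =>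
      (contDiffAt_topCoeff hβ hy).continuousAt.continuousWithinAt)]
  congr 1
  funext y
  have : topCoeff (α + β) i y = topCoeff α i y + topCoeff β i y := rfl
  rw [this]
  ring

/-- Each piece of the partition of unity is supported in both its own chart and the chart at `i`, so
it may be integrated in the latter; there the weights sum to 1. -/
theorem formIntegral_eq_chart {κ : DForm n S n} (hκ : IsSmoothForm κ) {i : S} {K : Set S}
    (hK : IsCompact K) (hKs : K ⊆ (extChartAt (𝓡 n) i).source) (h₀ : ∀ x, x ∉ K → κ x = 0) :
    formIntegral o κ = ∫ y in (extChartAt (𝓡 n) i).target, orientSign o i y * topCoeff κ i y := by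
  have hsmul : ∀ (j a : S) (y : Euc n),
      chartPartition n S j ((extChartAt (𝓡 n) a).symm y) * (orientSign o a y * topCoeff κ a y)
        = orientSign o a y * topCoeff (fun x => chartPartition n S j x • κ x) a y := by
    intro j a y
    have : topCoeff (fun x => chartPartition n S j x • κ x) a y
        = chartPartition n S j ((extChartAt (𝓡 n) a).symm y) * topCoeff κ a y := rfl
    rw [this]
    ring
  have hj : ∀ j, ∫ y in (extChartAt (𝓡 n) j).target,
      chartPartition n S j ((extChartAt (𝓡 n) j).symm y) * (orientSign o j y * topCoeff κ j y)
      = ∫ y in (extChartAt (𝓡 n) i).target,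
        chartPartition n S j ((extChartAt (𝓡 n) i).symm y) * (orientSign o i y * topCoeff κ i y) := by
    intro j
    simp only [hsmul]
    refine setIntegral_chart_eq o fun x hx => ⟨?_, ?_⟩
    · refine tsupport_chartPartition_subset j (subset_tsupport _ fun h => hx ?_)
      rw [h, zero_smul]
    · refine hKs (by_contra fun h => hx ?_)
      rw [h₀ x h, smul_zero]
  rw [formIntegral_eq_sum, Finset.sum_congr rfl fun j _ => hj j, ← integral_finsetSum]
  · congr 1
    funext y
    rw [← Finset.sum_mul, sum_chartPartition, one_mul]
  · intro j _
    refine integrableOn_extChartAt_target hK hKs (continuousOn_chart_integrand ho ho₀ j i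
      fun y hy => (contDiffAt_topCoeff hκ hy).continuousAt.continuousWithinAt) fun y _ h => ?_
    rw [topCoeff_eq_zero (h₀ _ h), mul_zero, mul_zero]

end Oriented

end ClosedManifold

/-! ### Stokes' theorem on a closed manifold -/

/-- Integration by parts against the constant function 1. -/
theorem integral_fderiv_apply_eq_zero {E : Type*} [NormedAddCommGroup E] [NormedSpace ℝ E]
    [FiniteDimensional ℝ E] [MeasurableSpace E] [BorelSpace E] (μ : Measure E) [μ.IsAddHaarMeasure]
    {f : E → ℝ} (hf : ContDiff ℝ 1 f) (hc : HasCompactSupport f) (v : E) :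
    ∫ y, fderiv ℝ f y v ∂μ = 0 := by
  have h' : Integrable (fun y => fderiv ℝ f y v) μ := by
    refine Continuous.integrable_of_hasCompactSupport
      ((hf.continuous_fderiv (by simp)).clm_apply continuous_const) ?_
    exact (hc.fderiv (𝕜 := ℝ)).comp_left (g := fun L : E →L[ℝ] ℝ => L v) rfl
  have := integral_mul_fderiv_eq_neg_fderiv_mul_of_integrable (𝕜 := ℝ) (f := fun _ : E => (1 : ℝ))
    (g := f) (v := v) (μ := μ) (by simp) (by simpa using h')
    (by simpa using hf.continuous.integrable_of_hasCompactSupport hc)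
    (fun _ _ => differentiableAt_const _) (fun x _ => hf.differentiable (by simp) x)
  simpa using this

/-- Extension of `f` by zero is differentiable on the whole space because `f` already vanishes on
`U` off the compact set `K`. -/
theorem setIntegral_fderiv_apply_eq_zero {E : Type*} [NormedAddCommGroup E] [NormedSpace ℝ E]
    [FiniteDimensional ℝ E] [MeasurableSpace E] [BorelSpace E] (μ : Measure E) [μ.IsAddHaarMeasure]
    {U K : Set E} (hU : IsOpen U) (hK : IsCompact K) (hKU : K ⊆ U)
    {f : E → ℝ} (hf : ∀ y ∈ U, ContDiffAt ℝ 1 f y) (h₀ : ∀ y ∈ U, y ∉ K → f y = 0) (v : E) :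
    ∫ y in U, fderiv ℝ f y v ∂μ = 0 := by
  have hsupp : ∀ y, y ∉ K → U.indicator f y = 0 := fun y hy => by
    by_cases h : y ∈ U
    · rw [indicator_of_mem h, h₀ y h hy]
    · exact indicator_of_notMem h f
  have hin : ∀ y ∈ U, U.indicator f =ᶠ[𝓝 y] f := fun y hy => by
    filter_upwards [hU.mem_nhds hy] with w hw
    exact indicator_of_mem hw f
  have hout : ∀ y, y ∉ K → U.indicator f =ᶠ[𝓝 y] fun _ => 0 := fun y hy => by
    filter_upwards [hK.isClosed.isOpen_compl.mem_nhds hy] with w hw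
    exact hsupp w hw
  rw [← integral_indicator hU.measurableSet, ← integral_fderiv_apply_eq_zero μ (f := U.indicator f)
    (contDiff_iff_contDiffAt.2 fun y => ?_) (HasCompactSupport.intro hK hsupp) v]
  · congr 1
    funext y
    by_cases hy : y ∈ U
    · rw [indicator_of_mem hy, (hin y hy).fderiv_eq]
    · rw [indicator_of_notMem hy, (hout y fun h => hy (hKU h)).fderiv_eq]
      simp
  · by_cases hy : y ∈ U
    · exact (hf y hy).congr_of_eventuallyEq (hin y hy)
    · exact contDiffAt_const.congr_of_eventuallyEq (hout y fun h => hy (hKU h))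

section Stokes

variable {k : ℕ} {S : Type*} [TopologicalSpace S] [ChartedSpace (Euc (k + 1)) S]
  [IsManifold (𝓡 (k + 1)) ∞ S] [CompactSpace S] [T2Space S]

theorem extD_eq_zero {m p : ℕ} {X : Type*} [TopologicalSpace X] [ChartedSpace (Euc m) X]
    [IsManifold (𝓡 m) ∞ X] {κ : DForm m X p} {x : X} (h : ∀ᶠ z in 𝓝 x, κ z = 0) :
    extD κ x = 0 := by
  have h1 : coordForm κ x =ᶠ[𝓝 (extChartAt (𝓡 m) x x)] fun _ => 0 := by
    have := (continuousAt_extChartAt_symm (I := 𝓡 m) x)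
    rw [ContinuousAt, extChartAt_to_inv] at this
    filter_upwards [this.eventually h] with w hw
    exact coordForm_eq_zero hw
  rw [extD, h1.extDeriv_eq, extDeriv, fderiv_fun_const]
  exact map_zero (ContinuousAlternatingMap.alternatizeUncurryFinCLM ℝ (Euc m) ℝ)

theorem smoothFormAt_zero {m p : ℕ} {X : Type*} [TopologicalSpace X] [ChartedSpace (Euc m) X]
    [IsManifold (𝓡 m) ∞ X] (x : X) : SmoothFormAt (0 : DForm m X p) x := by
  have : coordForm (0 : DForm m X p) x = fun _ => 0 := by
    funext y; exact coordForm_eq_zero rfl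
  rw [SmoothFormAt, this]
  exact contDiffAt_const

theorem isSmoothForm_finset_sum {m p : ℕ} {X ι : Type*} [TopologicalSpace X]
    [ChartedSpace (Euc m) X] [IsManifold (𝓡 m) ∞ X] (I : Finset ι) {κ : ι → DForm m X p}
    (hκ : ∀ i ∈ I, IsSmoothForm (κ i)) : IsSmoothForm (∑ i ∈ I, κ i) := by
  refine Finset.sum_induction _ IsSmoothForm (fun a b ha hb => ?_) ?_ hκ
  · exact isSmoothForm_iff.2 fun x => (ha.smoothFormAt x).add (hb.smoothFormAt x)
  · exact isSmoothForm_iff.2 smoothFormAt_zero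

theorem formIntegral_zero {n : ℕ} {S : Type*} [TopologicalSpace S] [ChartedSpace (Euc n) S]
    [IsManifold (𝓡 n) ∞ S] [CompactSpace S] [T2Space S] (o : DForm n S n) :
    formIntegral o 0 = 0 := by
  rw [formIntegral_eq_sum]
  refine Finset.sum_eq_zero fun i _ => ?_
  have : ∀ y, topCoeff (0 : DForm n S n) i y = 0 := fun y => topCoeff_eq_zero rfl
  simp [this]

/-- Stokes' theorem for a form supported in a chart. -/
theorem formIntegral_extD_eq_zero_of_chart {o : DForm (k + 1) S (k + 1)} (ho : IsSmoothForm o)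
    (ho₀ : ∀ x, o x ≠ 0) {κ : DForm (k + 1) S k} (hκ : IsSmoothForm κ) {i : S} {K : Set S}
    (hK : IsCompact K) (hKs : K ⊆ (extChartAt (𝓡 (k + 1)) i).source) (h₀ : ∀ x, x ∉ K → κ x = 0) :
    formIntegral o (extD κ) = 0 := by
  rw [formIntegral_eq_chart ho ho₀ hκ.extD hK hKs fun x hx =>
    extD_eq_zero (by filter_upwards [hK.isClosed.isOpen_compl.mem_nhds hx] with z hz using h₀ z hz)]
  set e : Fin (k + 1) → Euc (k + 1) := fun j => EuclideanSpace.single j (1 : ℝ) with he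
  -- The component of `κ` with the `j`-th basis vector omitted. The sign is included in `f`, which
  -- is harmless because it is locally constant.
  set f : Fin (k + 1) → Euc (k + 1) → ℝ := fun j y =>
    orientSign o i y * coordForm κ i y (j.removeNth e) with hf
  have hsm : ∀ y ∈ (extChartAt (𝓡 (k + 1)) i).target, ContDiffAt ℝ ∞ (coordForm κ i) y :=
    fun y hy => contDiffAt_coordForm hy (hκ.smoothFormAt _)
  have hfe : ∀ j, ∀ y ∈ (extChartAt (𝓡 (k + 1)) i).target,
      f j =ᶠ[𝓝 y] fun w => orientSign o i y * coordForm κ i w (j.removeNth e) := by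
    intro j y hy
    filter_upwards [orientSign_eventually_eq ho ho₀ hy] with w hw
    rw [hf, ← hw]
  have hfc : ∀ j, ∀ y ∈ (extChartAt (𝓡 (k + 1)) i).target, ContDiffAt ℝ ∞ (f j) y := fun j y hy =>
    (contDiffAt_const.mul (contDiffAt_alternating_iff.1 (hsm y hy) _)).congr_of_eventuallyEq
      (hfe j y hy)
  have hK' : IsCompact (extChartAt (𝓡 (k + 1)) i '' K) :=
    hK.image_of_continuousOn ((continuousOn_extChartAt i).mono hKs)
  have hsub : extChartAt (𝓡 (k + 1)) i '' K ⊆ (extChartAt (𝓡 (k + 1)) i).target := by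
    rintro _ ⟨x, hx, rfl⟩
    exact (extChartAt (𝓡 (k + 1)) i).map_source (hKs hx)
  have hf0 : ∀ j, ∀ y ∈ (extChartAt (𝓡 (k + 1)) i).target,
      y ∉ extChartAt (𝓡 (k + 1)) i '' K → f j y = 0 := by
    intro j y hy hn
    have : κ ((extChartAt (𝓡 (k + 1)) i).symm y) = 0 := h₀ _ fun hm =>
      hn ⟨_, hm, (extChartAt (𝓡 (k + 1)) i).right_inv hy⟩
    simp only [hf, coordForm_eq_zero this]
    simp
  -- The top coefficient of `dκ` is a divergence, and each partial derivative integrates to zero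
  -- separately.
  have hd : ∀ y ∈ (extChartAt (𝓡 (k + 1)) i).target,
      orientSign o i y * topCoeff (extD κ) i y
        = ∑ j : Fin (k + 1), (-1 : ℝ) ^ (j : ℕ) * fderiv ℝ (f j) y (e j) := by
    intro y hy
    rw [topCoeff, coordForm_extD hy (hκ.smoothFormAt _),
      extDeriv_apply ((hsm y hy).differentiableAt (by simp)), Finset.mul_sum]
    refine Finset.sum_congr rfl fun j _ => ?_
    rw [(hfe j y hy).fderiv_eq, fderiv_const_mul
      ((contDiffAt_alternating_iff.1 (hsm y hy) _).differentiableAt (by simp))]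
    simp only [_root_.smul_apply, smul_eq_mul]
    ring
  have hfd : ∀ j : Fin (k + 1), IntegrableOn (fun y => (-1 : ℝ) ^ (j : ℕ) * fderiv ℝ (f j) y (e j))
      (extChartAt (𝓡 (k + 1)) i).target := by
    intro j
    refine integrableOn_extChartAt_target hK hKs (fun y hy => ?_) fun y hy hn => ?_
    · refine ContinuousAt.continuousWithinAt (continuousAt_const.mul ?_)
      exact ((hfc j y hy).fderiv_right (m := ∞) (by simp)).continuousAt.clm_apply continuousAt_const
    · have : f j =ᶠ[𝓝 y] fun _ => 0 := by
        have hc := (continuousAt_extChartAt_symm'' (I := 𝓡 (k + 1)) hy).eventually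
          (hK.isClosed.isOpen_compl.mem_nhds hn)
        filter_upwards [hc] with w hw
        simp only [hf, coordForm_eq_zero (h₀ _ hw)]
        simp
      rw [this.fderiv_eq]
      simp
  rw [setIntegral_congr_fun (isOpen_extChartAt_target i).measurableSet hd, integral_finsetSum _
    fun j _ => hfd j]
  refine Finset.sum_eq_zero fun j _ => ?_
  rw [integral_const_mul, setIntegral_fderiv_apply_eq_zero volume (isOpen_extChartAt_target i) hK' hsub
    (fun y hy => (hfc j y hy).of_le (by simp)) (hf0 j), mul_zero]

theorem isSmoothForm_chartPartition_smul {p : ℕ} {γ : DForm (k + 1) S p} (hγ : IsSmoothForm γ)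
    (i : S) : IsSmoothForm (fun x => chartPartition (k + 1) S i x • γ x) := by
  intro x₀ y hy
  exact ((contDiffAt_chartPartition i hy).smul
    (contDiffAt_coordForm hy (hγ.smoothFormAt _))).contDiffWithinAt

theorem extD_finset_sum {m p : ℕ} {X ι : Type*} [TopologicalSpace X]
    [ChartedSpace (Euc m) X] [IsManifold (𝓡 m) ∞ X] (I : Finset ι) {κ : ι → DForm m X p}
    (hκ : ∀ i ∈ I, IsSmoothForm (κ i)) : extD (∑ i ∈ I, κ i) = ∑ i ∈ I, extD (κ i) := by
  classical
  induction I using Finset.induction_on with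
  | empty => funext x; exact extD_eq_zero (Eventually.of_forall fun _ => rfl)
  | insert a I ha ih =>
    rw [Finset.sum_insert ha, Finset.sum_insert ha, ← ih fun i hi => hκ i (Finset.mem_insert_of_mem hi)]
    funext x
    exact extD_add ((hκ a (Finset.mem_insert_self a I)).smoothFormAt x)
      ((isSmoothForm_finset_sum I fun i hi => hκ i (Finset.mem_insert_of_mem hi)).smoothFormAt x)

theorem formIntegral_finset_sum {n : ℕ} {S : Type*} [TopologicalSpace S] [ChartedSpace (Euc n) S]
    [IsManifold (𝓡 n) ∞ S] [CompactSpace S] [T2Space S] {ι : Type*} {o : DForm n S n}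
    (ho : IsSmoothForm o) (ho₀ : ∀ x, o x ≠ 0) (I : Finset ι) {κ : ι → DForm n S n}
    (hκ : ∀ i ∈ I, IsSmoothForm (κ i)) :
    formIntegral o (∑ i ∈ I, κ i) = ∑ i ∈ I, formIntegral o (κ i) := by
  classical
  induction I using Finset.induction_on with
  | empty => exact formIntegral_zero o
  | insert a I ha ih =>
    rw [Finset.sum_insert ha, Finset.sum_insert ha, ← ih fun i hi => hκ i (Finset.mem_insert_of_mem hi)]
    exact formIntegral_add ho ho₀ (hκ a (Finset.mem_insert_self a I))
      (isSmoothForm_finset_sum I fun i hi => hκ i (Finset.mem_insert_of_mem hi))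

/-- Stokes' theorem on a closed manifold. -/
theorem formIntegral_extD_eq_zero {o : DForm (k + 1) S (k + 1)} (ho : IsSmoothForm o)
    (ho₀ : ∀ x, o x ≠ 0) {γ : DForm (k + 1) S k} (hγ : IsSmoothForm γ) :
    formIntegral o (extD γ) = 0 := by
  have hs := fun i => isSmoothForm_chartPartition_smul hγ i
  have h : γ = ∑ i ∈ chartIndex (k + 1) S, fun x => chartPartition (k + 1) S i x • γ x := by
    funext x
    rw [Finset.sum_apply, ← Finset.sum_smul, sum_chartPartition, one_smul]
  rw [h, extD_finset_sum _ fun i _ => hs i, formIntegral_finset_sum ho ho₀ _ fun i _ => (hs i).extD]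
  refine Finset.sum_eq_zero fun i _ => ?_
  refine formIntegral_extD_eq_zero_of_chart ho ho₀ (hs i) (isCompact_tsupport_chartPartition i)
    (tsupport_chartPartition_subset i) fun x hx => ?_
  rw [chartPartition_eq_zero_of_notMem hx, zero_smul]

end Stokes

/-! ### Forms on a cylinder -/

section VectorSpace

variable {E : Type*} [NormedAddCommGroup E] [NormedSpace ℝ E]

/-- Cartan's formula in degree zero, where there is no form to contract; it serves the case of
zero-dimensional cuts. -/
theorem extDeriv_zero_form_curryLeft {A : E → E [⋀^Fin 0]→L[ℝ] ℝ} {x : E}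
    (hA : DifferentiableAt ℝ A x) (v : E) :
    (extDeriv A x).curryLeft v = fderiv ℝ A x v := by
  ext u
  have h := fderiv_continuousAlternatingMap_apply_const_apply hA u v
  rw [ContinuousAlternatingMap.curryLeft_apply_apply, extDeriv_apply hA, Fin.sum_univ_one]
  have : (fun y => A y ((0 : Fin 1).removeNth (Matrix.vecCons v u))) = fun y => A y u := by
    funext y; congr 1
  rw [this]
  simpa using h

/-- Cartan's formula for the constant field `∂_t`, restricted to a slice. The restriction commutes
with `d`, so the exact term becomes an exterior derivative on the slice. -/
theorem extDeriv_curryLeft_inl {k : ℕ} {A : ℝ × E → (ℝ × E) [⋀^Fin (k + 1)]→L[ℝ] ℝ} {t : ℝ} {y : E}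
    (hA : ContDiffAt ℝ ∞ A (t, y)) :
    ((extDeriv A (t, y)).curryLeft (1, 0)).compContinuousLinearMap (ContinuousLinearMap.inr ℝ ℝ E)
      = (fderiv ℝ A (t, y) (1, 0)).compContinuousLinearMap (ContinuousLinearMap.inr ℝ ℝ E)
        - extDeriv (fun z => ((A (t, z)).curryLeft (1, 0)).compContinuousLinearMap
            (ContinuousLinearMap.inr ℝ ℝ E)) y := by
  have h1 := extDeriv_curryLeft (v := fun _ => ((1, 0) : ℝ × E)) (hA.differentiableAt (by simp))
    (differentiableAt_const _)
  have hc : ContDiffAt ℝ ∞ (fun p => (A p).curryLeft ((1, 0) : ℝ × E)) (t, y) :=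
    contDiffAt_curryLeft_apply hA contDiffAt_const
  have hf : ∀ z : E, HasFDerivAt (fun z : E => (t, z)) (ContinuousLinearMap.inr ℝ ℝ E) z :=
    fun z => hasFDerivAt_prodMk_right t z
  have h2 := extDeriv_pullback (f := fun z : E => (t, z)) (x := y) (r := ∞)
    (hc.differentiableAt (by simp)) (by fun_prop)
    (by simpa using WithTop.coe_le_coe.2 (le_top : (2 : ℕ∞) ≤ ⊤))
  simp only [(hf _).fderiv] at h2
  rw [h2]
  have h3 : (extDeriv A (t, y)).curryLeft (1, 0) = fderiv ℝ A (t, y) (1, 0)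
      - extDeriv (fun p => (A p).curryLeft ((1, 0) : ℝ × E)) (t, y) := by
    rw [eq_sub_iff_add_eq]
    refine (add_comm _ _).trans (h1.trans ?_)
    rw [fderiv_fun_const]
    ext u
    simp
  rw [h3]
  rfl

/-- The fundamental theorem of calculus under the integral sign. -/
theorem integral_weight_mul_sub [FiniteDimensional ℝ E] [MeasurableSpace E] [BorelSpace E]
    (μ : Measure E) [μ.IsAddHaarMeasure] {U K : Set E} (hU : IsOpen U) (hK : IsCompact K) (hKU : K ⊆ U)
    {w : E → ℝ} (hw : ContinuousOn w U) (h₀ : ∀ y ∈ U, y ∉ K → w y = 0)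
    {a b : ℝ → E → ℝ} (ha : ∀ t, ContinuousOn (a t) U)
    (hb : ContinuousOn (fun p : ℝ × E => b p.1 p.2) (univ ×ˢ U))
    (hab : ∀ t, ∀ y ∈ U, HasDerivAt (fun s => a s y) (b t y) t) :
    IntervalIntegrable (fun t => ∫ y in U, w y * b t y ∂μ) volume 0 1 ∧
    (∫ y in U, w y * a 1 y ∂μ) - ∫ y in U, w y * a 0 y ∂μ
      = ∫ t in (0 : ℝ)..1, ∫ y in U, w y * b t y ∂μ := by
  have hres : ∀ f : E → ℝ, ∫ y in U, w y * f y ∂μ = ∫ y in K, w y * f y ∂μ := fun f =>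
    setIntegral_eq_of_subset_of_forall_sdiff_eq_zero hU.measurableSet hKU fun y hy => by
      rw [h₀ y hy.1 hy.2, zero_mul]
  simp only [hres]
  have hca : ∀ t, IntegrableOn (fun y => w y * a t y) K μ := fun t =>
    ((hw.mul (ha t)).mono hKU).integrableOn_compact hK
  have hcb : ContinuousOn (fun p : ℝ × E => w p.2 * b p.1 p.2) (univ ×ˢ U) :=
    (hw.comp continuousOn_snd fun p hp => hp.2).mul hb
  -- Joint continuity on the compact set `[0,1] × K` justifies Fubini.
  have hI : Integrable (fun p : ℝ × E => w p.2 * b p.1 p.2)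
      ((volume.restrict (Ioc (0 : ℝ) 1)).prod (μ.restrict K)) := by
    rw [Measure.prod_restrict]
    refine IntegrableOn.mono_set (t := Icc (0 : ℝ) 1 ×ˢ K) ?_ (prod_mono Ioc_subset_Icc_self le_rfl)
    exact (hcb.mono (prod_mono (subset_univ _) hKU)).integrableOn_compact (isCompact_Icc.prod hK)
  refine ⟨(intervalIntegrable_iff_integrableOn_Ioc_of_le zero_le_one).2 hI.integral_prod_left, ?_⟩
  rw [← integral_sub (hca 1) (hca 0), intervalIntegral.integral_of_le zero_le_one,
    integral_integral_swap hI]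
  refine setIntegral_congr_fun hK.measurableSet fun y hy => ?_
  have hbc : Continuous fun t => b t y := by
    rw [← continuousOn_univ]
    exact hb.comp (f := fun t : ℝ => (t, y)) (by fun_prop) fun t _ => ⟨mem_univ _, hKU hy⟩
  have := intervalIntegral.integral_eq_sub_of_hasDerivAt (a := 0) (b := 1)
    (f := fun s => a s y) (fun t _ => hab t y (hKU hy)) (hbc.intervalIntegrable 0 1)
  rw [← mul_sub, ← this, ← intervalIntegral.integral_of_le zero_le_one,
    intervalIntegral.integral_const_mul]

end VectorSpace

section Cylinder

variable {n k : ℕ} {S : Type*} [TopologicalSpace S] [ChartedSpace (Euc n) S] [IsManifold (𝓡 n) ∞ S]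
  {N : Type*} [TopologicalSpace N] [ChartedSpace (Euc (n + 1)) N] [IsManifold (𝓡 (n + 1)) ∞ N]
  {Φ : ℝ × S → N}

/-- The map `Φ` from the cylinder over `S`, written in the chart at `i` of `S`. -/
def cylinderChart (Φ : ℝ × S → N) (i : S) : ℝ × Euc n → N :=
  fun p => Φ (p.1, (extChartAt (𝓡 n) i).symm p.2)

/-- The form `i_{∂_t} (Φ^* α)` on `{t} × S`. -/
def sliceContract (Φ : ℝ × S → N) (α : DForm (n + 1) N (k + 1)) (t : ℝ) : DForm n S k :=
  fun x =>
    ((α (Φ (t, x))).curryLeft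
        ((mfderiv 𝓘(ℝ, ℝ) (𝓡 (n + 1)) (fun s : ℝ => Φ (s, x)) t : ℝ →L[ℝ] Euc (n + 1)) 1)
      ).compContinuousLinearMap
      (mfderiv (𝓡 n) (𝓡 (n + 1)) (fun x' : S => Φ (t, x')) x : Euc n →L[ℝ] Euc (n + 1))

theorem contMDiff_slice (hΦ : ContMDiff (𝓘(ℝ, ℝ).prod (𝓡 n)) (𝓡 (n + 1)) ∞ Φ) (t : ℝ) :
    ContMDiff (𝓡 n) (𝓡 (n + 1)) ∞ fun x => Φ (t, x) :=
  hΦ.comp (contMDiff_const.prodMk contMDiff_id)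

theorem contMDiffAt_cylinderChart (hΦ : ContMDiff (𝓘(ℝ, ℝ).prod (𝓡 n)) (𝓡 (n + 1)) ∞ Φ) {i : S}
    {p : ℝ × Euc n} (hp : p.2 ∈ (extChartAt (𝓡 n) i).target) :
    ContMDiffAt 𝓘(ℝ, ℝ × Euc n) (𝓡 (n + 1)) ∞ (cylinderChart Φ i) p := by
  refine ContMDiffAt.comp p hΦ.contMDiffAt (ContMDiffAt.prodMk ?_ ?_)
  · exact contDiff_fst.contMDiff.contMDiffAt
  · exact ContMDiffAt.comp p (contMDiffAt_extChartAt_symm hp) contDiff_snd.contMDiff.contMDiffAt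

theorem mfderiv_cylinderChart_inr (hΦ : ContMDiff (𝓘(ℝ, ℝ).prod (𝓡 n)) (𝓡 (n + 1)) ∞ Φ) {i : S}
    {t : ℝ} {y : Euc n} (hy : y ∈ (extChartAt (𝓡 n) i).target) :
    (mfderiv 𝓘(ℝ, ℝ × Euc n) (𝓡 (n + 1)) (cylinderChart Φ i) (t, y) : ℝ × Euc n →L[ℝ] Euc (n + 1))
        ∘L ContinuousLinearMap.inr ℝ ℝ (Euc n)
      = (mfderiv (𝓡 n) (𝓡 (n + 1)) (fun x => Φ (t, x)) ((extChartAt (𝓡 n) i).symm y)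
          : Euc n →L[ℝ] Euc (n + 1)) ∘L
        tangentCoordChange (𝓡 n) i ((extChartAt (𝓡 n) i).symm y) ((extChartAt (𝓡 n) i).symm y) := by
  have hd : MDifferentiableAt 𝓘(ℝ, Euc n) 𝓘(ℝ, ℝ × Euc n) (fun z : Euc n => (t, z)) y :=
    DifferentiableAt.mdifferentiableAt (by fun_prop)
  have hm : (mfderiv 𝓘(ℝ, Euc n) 𝓘(ℝ, ℝ × Euc n) (fun z : Euc n => (t, z)) y
      : Euc n →L[ℝ] ℝ × Euc n) = ContinuousLinearMap.inr ℝ ℝ (Euc n) :=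
    mfderiv_eq_fderiv.trans (hasFDerivAt_prodMk_right t y).fderiv
  have h1 := mfderiv_comp y ((contMDiffAt_cylinderChart hΦ (p := (t, y)) hy).mdifferentiableAt
    (by simp)) hd
  have h2 := mfderiv_comp y ((contMDiff_slice hΦ t).mdifferentiable (by simp)
    ((extChartAt (𝓡 n) i).symm y)) ((contMDiffAt_extChartAt_symm hy).mdifferentiableAt (by simp))
  rw [← hm, ← mfderiv_extChartAt_symm hy]
  exact h1.symm.trans h2

theorem mfderiv_cylinderChart_inl (hΦ : ContMDiff (𝓘(ℝ, ℝ).prod (𝓡 n)) (𝓡 (n + 1)) ∞ Φ) {i : S}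
    {t : ℝ} {y : Euc n} (hy : y ∈ (extChartAt (𝓡 n) i).target) :
    (mfderiv 𝓘(ℝ, ℝ × Euc n) (𝓡 (n + 1)) (cylinderChart Φ i) (t, y) : ℝ × Euc n →L[ℝ] Euc (n + 1))
        (1, 0)
      = (mfderiv 𝓘(ℝ, ℝ) (𝓡 (n + 1)) (fun s : ℝ => Φ (s, (extChartAt (𝓡 n) i).symm y)) t
          : ℝ →L[ℝ] Euc (n + 1)) 1 := by
  have hd : MDifferentiableAt 𝓘(ℝ, ℝ) 𝓘(ℝ, ℝ × Euc n) (fun s : ℝ => (s, y)) t :=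
    DifferentiableAt.mdifferentiableAt (by fun_prop)
  have hm : (mfderiv 𝓘(ℝ, ℝ) 𝓘(ℝ, ℝ × Euc n) (fun s : ℝ => (s, y)) t
      : ℝ →L[ℝ] ℝ × Euc n) = ContinuousLinearMap.inl ℝ ℝ (Euc n) :=
    mfderiv_eq_fderiv.trans (hasFDerivAt_prodMk_left t y).fderiv
  have h1 := mfderiv_comp t ((contMDiffAt_cylinderChart hΦ (p := (t, y)) hy).mdifferentiableAt
    (by simp)) hd
  have h2 := congrArg (fun L : ℝ →L[ℝ] Euc (n + 1) => L 1) h1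
  have h3 := congrArg (fun L : ℝ →L[ℝ] ℝ × Euc n => L 1) hm
  refine Eq.trans ?_ h2.symm
  exact congrArg (mfderiv 𝓘(ℝ, ℝ × Euc n) (𝓡 (n + 1)) (cylinderChart Φ i) (t, y)
    : ℝ × Euc n →L[ℝ] Euc (n + 1)) h3.symm

theorem coordForm_pullback_slice (hΦ : ContMDiff (𝓘(ℝ, ℝ).prod (𝓡 n)) (𝓡 (n + 1)) ∞ Φ)
    (α : DForm (n + 1) N k) {i : S} (t : ℝ) {y : Euc n} (hy : y ∈ (extChartAt (𝓡 n) i).target) :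
    coordForm (pullback (r := n) (fun x => Φ (t, x)) α) i y
      = (pb (cylinderChart Φ i) α (t, y)).compContinuousLinearMap
          (ContinuousLinearMap.inr ℝ ℝ (Euc n)) := by
  have h := mfderiv_cylinderChart_inr hΦ (t := t) hy
  ext v
  exact congrArg (fun L : Euc n →L[ℝ] Euc (n + 1) =>
    α (Φ (t, (extChartAt (𝓡 n) i).symm y)) (fun j => L (v j))) h.symm

/-- Transfers the slice forms to `ℝ × ℝⁿ`: there `∂_t` is the constant vector `(1, 0)` and the slice
directions are the second factor. -/
theorem coordForm_sliceContract (hΦ : ContMDiff (𝓘(ℝ, ℝ).prod (𝓡 n)) (𝓡 (n + 1)) ∞ Φ)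
    (α : DForm (n + 1) N (k + 1)) {i : S} (t : ℝ) {y : Euc n}
    (hy : y ∈ (extChartAt (𝓡 n) i).target) :
    coordForm (sliceContract Φ α t) i y
      = ((pb (cylinderChart Φ i) α (t, y)).curryLeft (1, 0)).compContinuousLinearMap
          (ContinuousLinearMap.inr ℝ ℝ (Euc n)) := by
  have h := mfderiv_cylinderChart_inr hΦ (t := t) hy
  have h' := mfderiv_cylinderChart_inl hΦ (t := t) hy
  ext v
  have hv : ∀ j : Fin (k + 1), (Fin.cons ((mfderiv 𝓘(ℝ, ℝ) (𝓡 (n + 1))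
        (fun s : ℝ => Φ (s, (extChartAt (𝓡 n) i).symm y)) t : ℝ →L[ℝ] Euc (n + 1)) 1)
      (fun j => ((mfderiv (𝓡 n) (𝓡 (n + 1)) (fun x => Φ (t, x)) ((extChartAt (𝓡 n) i).symm y)
          : Euc n →L[ℝ] Euc (n + 1)) ∘L tangentCoordChange (𝓡 n) i
            ((extChartAt (𝓡 n) i).symm y) ((extChartAt (𝓡 n) i).symm y)) (v j)) :
        Fin (k + 1) → Euc (n + 1)) j
      = (mfderiv 𝓘(ℝ, ℝ × Euc n) (𝓡 (n + 1)) (cylinderChart Φ i) (t, y)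
          : ℝ × Euc n →L[ℝ] Euc (n + 1))
        ((Fin.cons ((1, 0) : ℝ × Euc n) (fun j => ((0 : ℝ), v j)) : Fin (k + 1) → ℝ × Euc n) j) := by
    intro j
    refine Fin.cases ?_ (fun j => ?_) j
    · exact h'.symm
    · exact (congrArg (fun L : Euc n →L[ℝ] Euc (n + 1) => L (v j)) h).symm
  exact congrArg (α (Φ (t, (extChartAt (𝓡 n) i).symm y))) (funext hv)

theorem isSmoothForm_sliceContract (hΦ : ContMDiff (𝓘(ℝ, ℝ).prod (𝓡 n)) (𝓡 (n + 1)) ∞ Φ)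
    {α : DForm (n + 1) N (k + 1)} (hα : IsSmoothForm α) (t : ℝ) :
    IsSmoothForm (sliceContract Φ α t) := by
  intro i y hy
  refine ContDiffAt.contDiffWithinAt ?_
  have h : ContDiffAt ℝ ∞ (fun z => pb (cylinderChart Φ i) α (t, z)) y :=
    ContDiffAt.comp (f := fun z => (t, z)) y
      (contDiffAt_pb (hα.smoothFormAt _) (contMDiffAt_cylinderChart hΦ (p := (t, y)) hy)) (by fun_prop)
  refine (contDiffAt_compContinuousLinearMap (contDiffAt_curryLeft_apply h
    (contDiffAt_const (c := ((1, 0) : ℝ × Euc n))))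
    (contDiffAt_const (c := ContinuousLinearMap.inr ℝ ℝ (Euc n)))).congr_of_eventuallyEq ?_
  filter_upwards [extChartAt_target_nhds hy] with z hz
  exact coordForm_sliceContract hΦ α t hz

end Cylinder

/-! ### The integral of a form over a moving cut -/

section Homotopy

variable {n : ℕ} {S : Type*} [TopologicalSpace S] [ChartedSpace (Euc n) S] [IsManifold (𝓡 n) ∞ S]
  {N : Type*} [TopologicalSpace N] [ChartedSpace (Euc (n + 1)) N] [IsManifold (𝓡 (n + 1)) ∞ N]
  {Φ : ℝ × S → N}

theorem contDiffAt_topCoeff_cylinder (hΦ : ContMDiff (𝓘(ℝ, ℝ).prod (𝓡 n)) (𝓡 (n + 1)) ∞ Φ)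
    {α : DForm (n + 1) N n} (hα : IsSmoothForm α) {i : S} {p : ℝ × Euc n}
    (hp : p.2 ∈ (extChartAt (𝓡 n) i).target) :
    ContDiffAt ℝ ∞ (fun q : ℝ × Euc n =>
      topCoeff (pullback (r := n) (fun x => Φ (q.1, x)) α) i q.2) p := by
  refine (contDiffAt_alternating_iff.1 (contDiffAt_pb (hα.smoothFormAt _)
    (contMDiffAt_cylinderChart hΦ hp)) fun j => ((0 : ℝ), EuclideanSpace.single j (1 : ℝ))
      ).congr_of_eventuallyEq ?_
  filter_upwards [continuousAt_snd.preimage_mem_nhds (extChartAt_target_nhds hp)] with q hq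
  rw [topCoeff, coordForm_pullback_slice hΦ α q.1 hq]
  rfl

theorem hasDerivAt_topCoeff_cylinder (hΦ : ContMDiff (𝓘(ℝ, ℝ).prod (𝓡 n)) (𝓡 (n + 1)) ∞ Φ)
    {α : DForm (n + 1) N n} (hα : IsSmoothForm α) {i : S} (t : ℝ) {y : Euc n}
    (hy : y ∈ (extChartAt (𝓡 n) i).target) :
    HasDerivAt (fun s => topCoeff (pullback (r := n) (fun x => Φ (s, x)) α) i y)
      (fderiv ℝ (pb (cylinderChart Φ i) α) (t, y) (1, 0)
        fun j => ((0 : ℝ), EuclideanSpace.single j (1 : ℝ))) t := by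
  have hA : ContDiffAt ℝ ∞ (pb (cylinderChart Φ i) α) (t, y) :=
    contDiffAt_pb (hα.smoothFormAt _) (contMDiffAt_cylinderChart hΦ hy)
  have h1 : HasDerivAt (fun s : ℝ => (s, y)) ((1, 0) : ℝ × Euc n) t :=
    (hasDerivAt_id t).prodMk (hasDerivAt_const t y)
  have h2 := (hA.differentiableAt (by simp)).hasFDerivAt.comp_hasDerivAt t h1
  have h3 := ((ContinuousAlternatingMap.apply ℝ (ℝ × Euc n) ℝ
    (fun j => ((0 : ℝ), EuclideanSpace.single j (1 : ℝ)))).hasFDerivAt).comp_hasDerivAt t h2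
  refine h3.congr_of_eventuallyEq (Eventually.of_forall fun s => ?_)
  simp only
  rw [topCoeff, coordForm_pullback_slice hΦ α s hy]
  rfl

theorem topCoeff_slicePullback_extD (hΦ : ContMDiff (𝓘(ℝ, ℝ).prod (𝓡 n)) (𝓡 (n + 1)) ∞ Φ)
    {α : DForm (n + 1) N n} (hα : IsSmoothForm α) {i : S} (t : ℝ) {y : Euc n}
    (hy : y ∈ (extChartAt (𝓡 n) i).target) :
    topCoeff (slicePullback Φ (extD α) t) i y
      = ((extDeriv (pb (cylinderChart Φ i) α) (t, y)).curryLeft (1, 0)).compContinuousLinearMap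
          (ContinuousLinearMap.inr ℝ ℝ (Euc n)) fun j => EuclideanSpace.single j (1 : ℝ) := by
  rw [extDeriv_pb (hα.smoothFormAt _) (contMDiffAt_cylinderChart hΦ hy),
    ← coordForm_sliceContract hΦ _ t hy]
  rfl

/-- The homotopy formula for `d/dt Φ_t^* α`. Here `ε t` stands for the exact term `d(i_{∂_t} Φ^*
α)`, and all that is needed of it later is that it is smooth and integrates to zero. -/
theorem exists_exact_correction [CompactSpace S] [T2Space S]
    (hΦ : ContMDiff (𝓘(ℝ, ℝ).prod (𝓡 n)) (𝓡 (n + 1)) ∞ Φ)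
    {α : DForm (n + 1) N n} (hα : IsSmoothForm α) :
    ∃ ε : ℝ → DForm n S n, (∀ t, IsSmoothForm (ε t)) ∧
      (∀ t (o : DForm n S n), IsSmoothForm o → (∀ x, o x ≠ 0) → formIntegral o (ε t) = 0) ∧
      ∀ (i : S) (t : ℝ), ∀ y ∈ (extChartAt (𝓡 n) i).target,
        HasDerivAt (fun s => topCoeff (pullback (r := n) (fun x => Φ (s, x)) α) i y)
          (topCoeff (slicePullback Φ (extD α) t + ε t) i y) t := by
  have hA : ∀ (i : S) (t : ℝ), ∀ y ∈ (extChartAt (𝓡 n) i).target,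
      ContDiffAt ℝ ∞ (pb (cylinderChart Φ i) α) (t, y) := fun i t y hy =>
    contDiffAt_pb (hα.smoothFormAt _) (contMDiffAt_cylinderChart hΦ hy)
  have hadd : ∀ (β γ : DForm n S n) (i : S) (y : Euc n),
      topCoeff (β + γ) i y = topCoeff β i y + topCoeff γ i y := fun _ _ _ _ => rfl
  -- For `n = 0` the form `α` is a function and `i_{∂_t} Φ^* α` does not exist; the correction is
  -- zero. Otherwise its integral vanishes by Stokes' theorem on `S`.
  rcases n with _ | k
  · refine ⟨fun _ => 0, fun _ => isSmoothForm_iff.2 smoothFormAt_zero,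
      fun _ o _ _ => formIntegral_zero o, fun i t y hy => ?_⟩
    convert hasDerivAt_topCoeff_cylinder hΦ hα t hy using 1
    rw [add_zero, topCoeff_slicePullback_extD hΦ hα t hy,
      extDeriv_zero_form_curryLeft ((hA i t y hy).differentiableAt (by simp))]
    rfl
  · have hs := fun t => isSmoothForm_sliceContract hΦ hα t
    refine ⟨fun t => extD (sliceContract Φ α t), fun t => (hs t).extD,
      fun t o ho ho₀ => formIntegral_extD_eq_zero ho ho₀ (hs t), fun i t y hy => ?_⟩
    convert hasDerivAt_topCoeff_cylinder hΦ hα t hy using 1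
    have he : coordForm (sliceContract Φ α t) i =ᶠ[𝓝 y] fun z =>
        ((pb (cylinderChart Φ i) α (t, z)).curryLeft (1, 0)).compContinuousLinearMap
          (ContinuousLinearMap.inr ℝ ℝ (Euc (k + 1))) := by
      filter_upwards [extChartAt_target_nhds hy] with z hz
      exact coordForm_sliceContract hΦ α t hz
    have h2 : topCoeff (extD (sliceContract Φ α t)) i y = extDeriv (fun z =>
        ((pb (cylinderChart Φ i) α (t, z)).curryLeft (1, 0)).compContinuousLinearMap
          (ContinuousLinearMap.inr ℝ ℝ (Euc (k + 1)))) y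
            fun j => EuclideanSpace.single j (1 : ℝ) := by
      rw [topCoeff, coordForm_extD hy ((hs t).smoothFormAt _), he.extDeriv_eq]
    rw [hadd, topCoeff_slicePullback_extD hΦ hα t hy, extDeriv_curryLeft_inl (hA i t y hy), h2]
    exact sub_add_cancel _ _

/-- The change of the integral of a form along a moving cut. -/
theorem formIntegral_pullback_sub [CompactSpace S] [T2Space S]
    (hΦ : ContMDiff (𝓘(ℝ, ℝ).prod (𝓡 n)) (𝓡 (n + 1)) ∞ Φ)
    {α : DForm (n + 1) N n} (hα : IsSmoothForm α) {o : DForm n S n} (ho : IsSmoothForm o)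
    (ho₀ : ∀ x, o x ≠ 0) :
    formIntegral o (pullback (r := n) (fun x => Φ (1, x)) α)
        - formIntegral o (pullback (r := n) (fun x => Φ (0, x)) α)
      = ∫ t in (0 : ℝ)..1, formIntegral o (slicePullback Φ (extD α) t) := by
  obtain ⟨ε, hε, hε₀, hd⟩ := exists_exact_correction hΦ hα
  have hs : ∀ t, IsSmoothForm (slicePullback Φ (extD α) t) := fun t =>
    isSmoothForm_sliceContract hΦ hα.extD t
  have h1 : ∀ t, formIntegral o (slicePullback Φ (extD α) t)
      = formIntegral o (slicePullback Φ (extD α) t + ε t) := fun t => by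
    rw [formIntegral_add ho ho₀ (hs t) (hε t), hε₀ t o ho ho₀, add_zero]
  -- One chart at a time, with the partition function times the orientation sign as weight; it does
  -- not depend on time.
  have hp : ∀ i : S, _ := fun i => integral_weight_mul_sub (volume : Measure (Euc n))
    (isOpen_extChartAt_target (I := 𝓡 n) i)
    (K := extChartAt (𝓡 n) i '' tsupport (chartPartition n S i))
    ((isCompact_tsupport_chartPartition i).image_of_continuousOn
      ((continuousOn_extChartAt i).mono (tsupport_chartPartition_subset i)))
    (by
      rintro _ ⟨x, hx, rfl⟩
      exact (extChartAt (𝓡 n) i).map_source (tsupport_chartPartition_subset i hx))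
    (w := fun y => chartPartition n S i ((extChartAt (𝓡 n) i).symm y) * orientSign o i y)
    (by
      simpa using continuousOn_chart_integrand ho ho₀ i i (f := fun _ => 1) continuousOn_const)
    (fun y hy hn => by
      rw [chartPartition_eq_zero_of_notMem fun h =>
        hn ⟨_, h, (extChartAt (𝓡 n) i).right_inv hy⟩, zero_mul])
    (a := fun t y => topCoeff (pullback (r := n) (fun x => Φ (t, x)) α) i y)
    (b := fun t y => topCoeff (slicePullback Φ (extD α) t + ε t) i y)
    (fun t y hy => (ContinuousAt.comp (f := fun y : Euc n => (t, y))
      (contDiffAt_topCoeff_cylinder hΦ hα (p := (t, y)) hy).continuousAt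
      (by fun_prop)).continuousWithinAt)
    -- Joint continuity comes from uniqueness of derivatives: the integrand is the time derivative
    -- of a jointly smooth coefficient. No regularity of `ε` in `t` is required.
    (fun p hp => by
      refine ContinuousAt.continuousWithinAt ?_
      have hc := (((contDiffAt_topCoeff_cylinder hΦ hα hp.2).fderiv_right (m := ∞)
        (by simp)).continuousAt.clm_apply (continuousAt_const (y := ((1, 0) : ℝ × Euc n))))
      refine hc.congr ?_
      filter_upwards [continuousAt_snd.preimage_mem_nhds (extChartAt_target_nhds hp.2)] with q hq
      have h2 : HasDerivAt (fun s : ℝ => (s, q.2)) ((1, 0) : ℝ × Euc n) q.1 :=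
        (hasDerivAt_id q.1).prodMk (hasDerivAt_const q.1 q.2)
      have h3 := HasFDerivAt.comp_hasDerivAt (l := fun r : ℝ × Euc n =>
          topCoeff (pullback (r := n) (fun x => Φ (r.1, x)) α) i r.2) q.1
        ((contDiffAt_topCoeff_cylinder hΦ hα hq).differentiableAt (by simp)).hasFDerivAt h2
      exact h3.unique (hd i q.1 q.2 hq))
    (fun t y hy => hd i t y hy)
  simp only [h1, formIntegral_eq_sum]
  rw [intervalIntegral.integral_finsetSum fun i _ => by simpa only [mul_assoc] using (hp i).1,
    ← Finset.sum_sub_distrib]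
  refine Finset.sum_congr rfl fun i _ => ?_
  simpa only [mul_assoc] using (hp i).2

end Homotopy

/-! ### Orientation of the cuts against orientation of the region -/

section Sign

variable {n : ℕ} {S : Type*} [TopologicalSpace S] [ChartedSpace (Euc n) S] [IsManifold (𝓡 n) ∞ S]
  [CompactSpace S] [T2Space S]
  {N : Type*} [TopologicalSpace N] [ChartedSpace (Euc (n + 1)) N] [IsManifold (𝓡 (n + 1)) ∞ N]
  {Φ : ℝ × S → N}

theorem exists_eq_smul_of_top {m : ℕ} {a b : (Euc m) [⋀^Fin m]→L[ℝ] ℝ} (ha : a ≠ 0) :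
    ∃ c : ℝ, b = c • a := by
  let B := (EuclideanSpace.basisFun (Fin m) ℝ).toBasis
  have ha' : a B ≠ 0 := by
    have := apply_single_ne_zero ha
    have hb : (fun j => EuclideanSpace.single j (1 : ℝ)) = B := by
      funext j; simp [B]
    rwa [hb] at this
  have h : ∀ (f : (Euc m) [⋀^Fin m]→L[ℝ] ℝ) v, f v = f B * B.det v := fun f v =>
    congrArg (fun g : (Euc m) [⋀^Fin m]→ₗ[ℝ] ℝ => g v) (f.toAlternatingMap.eq_smul_basis_det B)
  refine ⟨b B / a B, ?_⟩
  ext v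
  rw [h b v, ContinuousAlternatingMap.smul_apply, h a v, smul_eq_mul]
  field_simp

theorem slicePullback_smul (Φ : ℝ × S → N) {η ζ : DForm (n + 1) N (n + 1)} {t : ℝ} {x : S} {c : ℝ}
    (h : ζ (Φ (t, x)) = c • η (Φ (t, x))) :
    slicePullback Φ ζ t x = c • slicePullback Φ η t x := by
  ext v
  simp only [slicePullback, h]
  rfl

/-- Reversing the orientation of the cuts reverses the sign of the integral. -/
theorem formIntegral_slicePullback {η ζ : DForm (n + 1) N (n + 1)} (hη₀ : ∀ q, η q ≠ 0)
    {μ : DForm n S n} (hμ₀ : ∀ x, μ x ≠ 0) (hopp : OppositeToBoundaryOfPast η Φ μ)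
    {t : ℝ} (ht : t ∈ Icc (0 : ℝ) 1) :
    formIntegral (slicePullback Φ η t) (slicePullback Φ ζ t)
      = - formIntegral μ (slicePullback Φ ζ t) := by
  rw [formIntegral_eq_sum, formIntegral_eq_sum, ← Finset.sum_neg_distrib]
  refine Finset.sum_congr rfl fun i _ => ?_
  rw [← integral_neg]
  refine setIntegral_congr_fun (isOpen_extChartAt_target i).measurableSet fun y hy => ?_
  set x := (extChartAt (𝓡 n) i).symm y with hx
  have hμ : topCoeff μ i y ≠ 0 := topCoeff_ne_zero hy (hμ₀ _)
  have hle : topCoeff (slicePullback Φ η t) i y * topCoeff μ i y ≤ 0 := hopp t ht x _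
  -- Top forms at a point are proportional. Hence `Φ^* ζ` vanishes wherever `Φ^* η` does, and points
  -- where `Φ` degenerates contribute nothing to either integral.
  obtain ⟨c, hc⟩ := exists_eq_smul_of_top (b := ζ (Φ (t, x))) (hη₀ (Φ (t, x)))
  have hζ : topCoeff (slicePullback Φ ζ t) i y = c * topCoeff (slicePullback Φ η t) i y := by
    have := slicePullback_smul Φ hc
    rw [topCoeff, coordForm]
    simp only [← hx, this]
    rfl
  simp only [orientSign, hζ]
  rcases lt_trichotomy (topCoeff (slicePullback Φ η t) i y) 0 with h | h | h
  · have : 0 < topCoeff μ i y := by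
      refine lt_of_le_of_ne ?_ hμ.symm
      by_contra h'
      exact absurd hle (not_le.2 (mul_pos_of_neg_of_neg h (not_le.1 h')))
    rw [Real.sign_of_neg h, Real.sign_of_pos this]
    ring
  · simp [h]
  · have : topCoeff μ i y < 0 := by
      refine lt_of_le_of_ne ?_ hμ
      by_contra h'
      exact absurd hle (not_le.2 (mul_pos h (not_le.1 h')))
    rw [Real.sign_of_pos h, Real.sign_of_neg this]
    ring

end Sign

/-! ### Contraction with a tangent vector field -/

section Tangency

variable {n : ℕ} {W : Type*} [NormedAddCommGroup W] [NormedSpace ℝ W]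
  {M : Type*} [TopologicalSpace M] [ChartedSpace (Euc (n + 2)) M] [IsManifold (𝓡 (n + 2)) ∞ M]
  {N : Type*} [TopologicalSpace N] [ChartedSpace (Euc (n + 1)) N] [IsManifold (𝓡 (n + 1)) ∞ N]

/-- The pullback to a hypersurface of the contraction of a top form with a tangent vector field
vanishes. -/
theorem pullback_stContract_eq_zero {ι : N → M} {ξ : (M → W) → VField (n + 2) M} {φ : M → W}
    (h : IsTangentTo ι (ξ φ)) (Λ : FSForm M W (n + 2) M 0 (n + 2)) :
    stPullback (r := n + 1) ι (stContract ξ Λ) φ ![] = 0 := by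
  funext q
  obtain ⟨v, hv⟩ := h q
  ext u
  set D : Euc (n + 1) →L[ℝ] Euc (n + 2) := mfderiv (𝓡 (n + 1)) (𝓡 (n + 2)) ι q with hD
  -- Tangency pulls all `n + 2` arguments of the top form back to the `(n + 1)`-dimensional tangent
  -- space of the hypersurface, where they are dependent.
  have hdep : ¬ LinearIndependent ℝ (Fin.cons v u : Fin (n + 2) → Euc (n + 1)) := fun hl => by
    have := hl.fintype_card_le_finrank
    simp at this
  have hz := (((Λ φ ![] (ι q)).compContinuousLinearMap D).toAlternatingMap).map_linearDependent _ hdep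
  have hv' : ∀ j : Fin (n + 2), (Fin.cons (ξ φ (ι q)) (fun j => D (u j)) : Fin (n + 2) → Euc (n + 2)) j
      = D ((Fin.cons v u : Fin (n + 2) → Euc (n + 1)) j) := fun j => by
    refine Fin.cases ?_ (fun j => ?_) j
    · exact hv.symm
    · rfl
  exact (congrArg (Λ φ ![] (ι q)) (funext hv')).trans hz

end Tangency

end CovPhase

end

/-! ### The identity for `dh_ξ` and the continuity equation -/

theorem mainTheorem2 {n : ℕ} {W : Type*} [NormedAddCommGroup W] [NormedSpace ℝ W]
    [FiniteDimensional ℝ W] (F : CovPhase.FieldType (n + 2) W)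
    {M : Type*} [TopologicalSpace M] [ChartedSpace (CovPhase.Euc (n + 2)) M]
    [IsManifold (𝓡 (n + 2)) ∞ M] [T2Space M] [SigmaCompactSpace M]
    (T : CovPhase.Theory F M) (U : Set M) (hU : IsOpen U)
    {N : Type*} [TopologicalSpace N] [ChartedSpace (CovPhase.Euc (n + 1)) N]
    [IsManifold (𝓡 (n + 1)) ∞ N]
    (ι : N → M) (hι : Manifold.IsSmoothEmbedding (𝓡 (n + 1)) (𝓡 (n + 2)) ∞ ι)
    (hιU : range ι ⊆ frontier U)
    (ℓ : CovPhase.FSForm M W (n + 2) M 0 (n + 1)) (hℓ : CovPhase.IsLocalForm F ℓ)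
    (β : CovPhase.FSForm M W (n + 2) M 1 n) (hβ : CovPhase.IsLocalForm F β)
    (ℰ : CovPhase.FSForm M W (n + 1) N 1 (n + 1))
    (hdec : CovPhase.IsBoundaryDecomposition T U ι ℓ β ℰ)
    (Q : CovPhase.VField (n + 2) M → CovPhase.FSForm M W (n + 2) M 0 n)
    (hQ : CovPhase.IsNoetherPotential T U Q)
    (ξ : (M → W) → CovPhase.VField (n + 2) M)
    (φ : M → W) (hφ : CovPhase.IsSolution T U φ) (hξ : CovPhase.IsSmoothVField (ξ φ)) :
    -- the identity for `dh_ξ` on `N`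
    (CovPhase.stD (CovPhase.stPullback ι (CovPhase.chargeDensity T Q ℓ β ξ)) φ ![]
      = CovPhase.fsContract (CovPhase.hat F ξ) ℰ φ ![]
        - CovPhase.stPullback ι (CovPhase.anomaly F ξ (ℓ + T.b)) φ ![]
        - CovPhase.stPullback ι
            (CovPhase.stContract ξ (T.L + CovPhase.stD ℓ)) φ ![]) ∧
    -- the anomalous continuity equation
    (CovPhase.IsTangentTo ι (ξ φ) →
      ∀ (η : CovPhase.DForm (n + 1) N (n + 1)), CovPhase.IsSmoothForm η → (∀ q, η q ≠ 0) →
      ∀ (S : Type*) [TopologicalSpace S] [ChartedSpace (CovPhase.Euc n) S]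
        [IsManifold (𝓡 n) ∞ S] [CompactSpace S] [T2Space S]
        (μ : CovPhase.DForm n S n), CovPhase.IsSmoothForm μ → (∀ x, μ x ≠ 0) →
      ∀ Φ : ℝ × S → N, ContMDiff (𝓘(ℝ, ℝ).prod (𝓡 n)) (𝓡 (n + 1)) ∞ Φ →
        CovPhase.OppositeToBoundaryOfPast η Φ μ →
        CovPhase.charge T Q ℓ β ξ ι μ (fun x => Φ (1, x)) φ
            - CovPhase.charge T Q ℓ β ξ ι μ (fun x => Φ (0, x)) φ
          = - CovPhase.regionIntegral η Φ
              (CovPhase.fsContract (CovPhase.hat F ξ) ℰ φ ![]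
                - CovPhase.stPullback ι (CovPhase.anomaly F ξ (ℓ + T.b)) φ ![])) := by
  refine ⟨CovPhase.stD_chargeDensity T hU hι.contMDiff hιU hℓ hβ hdec hQ hφ hξ, ?_⟩
  intro htan η _ hη₀ S _ _ _ _ _ μ hμ hμ₀ Φ hΦ hopp
  have hι' := hι.contMDiff
  have h1 := CovPhase.stD_chargeDensity T hU hι' hιU hℓ hβ hdec hQ hφ hξ
  have h0 : CovPhase.stPullback ι (CovPhase.stContract ξ (T.L + CovPhase.stD ℓ)) φ ![] = 0 :=
    CovPhase.pullback_stContract_eq_zero htan _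
  rw [h0, sub_zero] at h1
  have hh := CovPhase.isSmoothForm_chargeDensity T hℓ hβ hQ hφ hξ
  have hα : CovPhase.IsSmoothForm
      (CovPhase.pullback (r := n + 1) ι (CovPhase.chargeDensity T Q ℓ β ξ φ ![])) :=
    CovPhase.isSmoothForm_iff.2 fun q =>
      CovPhase.smoothFormAt_pullback hι' (hh.smoothFormAt _)
  have hc : ∀ t, CovPhase.charge T Q ℓ β ξ ι μ (fun x => Φ (t, x)) φ
      = CovPhase.formIntegral μ (CovPhase.pullback (r := n) (fun x => Φ (t, x))
          (CovPhase.pullback (r := n + 1) ι (CovPhase.chargeDensity T Q ℓ β ξ φ ![]))) := fun t => by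
    rw [CovPhase.charge, CovPhase.pullback_pullback hι' (CovPhase.contMDiff_slice hΦ t)]
  rw [hc, hc, CovPhase.formIntegral_pullback_sub hΦ hα hμ hμ₀, CovPhase.regionIntegral,
    ← intervalIntegral.integral_neg, ← h1]
  -- The minus sign in the claim cancels slice by slice against the one from reversing the
  -- orientation from `Φ^* η` to `μ`.
  refine intervalIntegral.integral_congr fun t ht => ?_
  rw [uIcc_of_le zero_le_one] at ht
  rw [CovPhase.formIntegral_slicePullback hη₀ hμ₀ hopp ht, neg_neg]
  rfl
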